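/- Call a group $H$ a $\mathcal K$-group if it is finite, satisfies $x^4=1$ for all $x\in H$ (that is, the exponent of $H$ divides $4$), and all its elements of order $2$ are central; every such group is nilpotent of class at most $2$. Let $\mathcal K$ be the class of all $\mathcal K$-groups, regarded as structures in the language $\{1,{}^{-1},\cdot\}$ of groups. A Fraïssé limit of $\mathcal K$ is a countable group $\mathcal G$ such that the finitely generated groups embeddable into $\mathcal G$ are exactly the groups in $\mathcal K$, and every isomorphism between finitely generated (equivalently, finite) subgroups of $\mathcal G$ extends to an automorphism of $\mathcal G$ (such a group is unique up to isomorphism). An AZ-enumeration of a countable structure $M$ is an ordering $<$ of $M$ of order type $\omega$ such that for every $n$ and every sequence $(\bar a_i)_{i\in\omega}$ of $n$-tuples of $M$ there are indices $i\neq j$ and an order preserving elementary map $\alpha:M\to M$ with $\alpha(\bar a_i)=\bar a_j$. A structure is called geometrically finite if it has an AZ-enumeration. Theorem. The class $\mathcal K$ has a Fraïssé limit. Let $\mathcal G$ be the Fraïssé limit of $\mathcal K$. Then $\mathcal G$ has no AZ-enumeration, i.e. $\mathcal G$ is not geometrically finite. Moreover $\mathcal G$ is an infinite $\omega$-categorical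 group (every countably infinite model of its complete first-order theory is isomorphic to it), it is nilpotent of class exactly $2$, and it has quantifier elimination (every first-order formula in the language of groups is equivalent in $\mathcal G$ to a quantifier-free formula in the same free variables). In particular, there is an $\omega$-categorical structure which is not geometrically finite. -/

import Mathlib

universe u

open scoped FirstOrder Cardinal

namespace NiceEnum

open FirstOrder FirstOrder.Language CategoryTheory

/-- The function symbols of the language of groups: the unit, inversion and multiplication. -/
inductive GroupFunc : ℕ → Type
  | one : GroupFunc 0
  | inv : GroupFunc 1
  | mul : GroupFunc 2

/-- The first-order language of groups. Its substructures are exactly the subgroups. -/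
def groupLang : FirstOrder.Language.{0, 0} where
  Functions := GroupFunc
  Relations := fun _ => Empty

instance : Countable (Σ n, groupLang.Functions n) := by
  have h : Function.Injective (fun x : (Σ n, groupLang.Functions n) => x.1) := by
    rintro ⟨n, f⟩ ⟨m, g⟩ rfl
    cases f <;> cases g <;> rfl
  exact h.countable

/-- Every group is a structure for the language of groups in the usual way. -/
instance groupStructure (G : Type*) [Group G] : groupLang.Structure G where
  funMap := fun {n} f =>
    match n, f with
    | _, GroupFunc.one => fun _ => 1
    | _, GroupFunc.inv => fun v => (v 0)⁻¹
    | _, GroupFunc.mul => fun v => v 0 * v 1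
  RelMap := fun r => r.elim

/-- The class of all finite groups of exponent (dividing) four in which all involutions are
central, as an isomorphism-closed class of structures for the language of groups. -/
def centralInvolutionClass : Set (Bundled.{u} groupLang.Structure) :=
  {M | ∃ (H : Type u) (_ : Group H), Finite H ∧ Monoid.exponent H ∣ 4 ∧
    (∀ x : H, orderOf x = 2 → x ∈ Subgroup.center H) ∧ Nonempty (M ≃[groupLang] H)}

section ModelTheory

variable (L : FirstOrder.Language.{0, 0}) (M : Type u) [L.Structure M]

/-- A structure is `ω`-categorical if it is countably infinite and every countably infinite model
of its complete theory is isomorphic to it. -/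
def IsOmegaCategorical : Prop :=
  Countable M ∧ Infinite M ∧ Cardinal.Categorical (ℵ₀ : Cardinal.{u}) (L.completeTheory M)

/-- A structure has quantifier elimination if every formula (in finitely many free variables) is
equivalent in it to a quantifier-free formula in the same free variables. -/
def HasQuantifierElimination : Prop :=
  ∀ (n : ℕ) (φ : L.Formula (Fin n)), ∃ ψ : L.Formula (Fin n),
    BoundedFormula.IsQF ψ ∧ ∀ v : Fin n → M, φ.Realize v ↔ ψ.Realize v

/-- An AZ-enumeration of `M`: an ordering `lt` of `M` of type `ω` such that, for every `n`, every
sequence of `n`-tuples has two terms with different indices, the first of which is mapped to the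
second by some order preserving elementary map `M → M`. -/
def IsAZEnumeration (lt : M → M → Prop) : Prop :=
  Nonempty (lt ≃r ((· < ·) : ℕ → ℕ → Prop)) ∧
  ∀ (n : ℕ) (a : ℕ → Fin n → M), ∃ i j : ℕ, i ≠ j ∧ ∃ α : M ↪ₑ[L] M,
    (∀ x y : M, lt x y → lt (α x) (α y)) ∧ ∀ k : Fin n, α (a i k) = a j k

/-- A structure is geometrically finite if it has an AZ-enumeration. -/
def GeometricallyFinite : Prop :=
  ∃ lt : M → M → Prop, IsAZEnumeration L M lt

end ModelTheory

end NiceEnum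

/-! The limit is realised as a central extension `BilinearGroup B` of `Vec` by `Vec`, where `Vec`
has countable dimension over the field with two elements. Squares are `(0, B x x)` and commutators
`(0, B x y + B y x)`, so for anisotropic `B` the solutions of `x ^ 2 = 1` form exactly the central
copy of `Vec`. If every consistent prescription of `B e e` and of `B e v + B v e` on a finite
subspace is met by some `e` (`IsGeneric`), the group realises all consistent one-element extensions
of finite subgroups (`IsRich`). Extending finite partial isomorphisms by `IsGraph.exists_extend`
then gives ultrahomogeneity and the required age. A generic `B` is built row by row in
`exists_generic_bilinearMap`.

The laws make finitely generated subgroups finite even in powers of the group, so there are only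
finitely many terms in given variables (`finitelyManyTerms`). With ultrahomogeneity this yields
quantifier elimination and `ω`-categoricity.

Against an ordering of type `ω`, let the `k`th initial segment contain the first `k + 1` basis
elements. Genericity provides two elements whose commutators on that segment encode the shift of the
basis truncated at `k`. An order preserving injective homomorphism taking the coding tuple of `i` to
that of `j` maps segment into segment, hence fixes basis elements modulo the centre one after the
other up to `min i j`; there one truncated shift stops and the other does not, unless `i = j`
(`IsGeneric.not_geometricallyFinite`). -/

namespace NiceEnum

open FirstOrder FirstOrder.Language Set

/-! ### Ultrahomogeneous structures with finitely many terms: quantifier elimination and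
categoricity. -/

section ModelTheory

variable {L : FirstOrder.Language.{0, 0}} {M : Type*} {N : Type*} {P : Type*}
  [L.Structure M] [L.Structure N] [L.Structure P] {α : Type}

/-- Two tuples satisfy the same equations between terms. -/
def SameTerms (L : FirstOrder.Language.{0, 0}) {M : Type*} {N : Type*}
    [L.Structure M] [L.Structure N] {α : Type} (u : α → M) (v : α → N) : Prop :=
  ∀ t s : L.Term α, t.realize u = s.realize u ↔ t.realize v = s.realize v

theorem mem_closure_range_iff {u : α → M} {x : M} :
    x ∈ Substructure.closure L (range u) ↔ ∃ t : L.Term α, t.realize u = x := by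
  constructor
  · intro hx
    obtain ⟨t, rfl⟩ := Substructure.mem_closure_iff_exists_term.1 hx
    refine ⟨t.relabel fun a => a.2.choose, ?_⟩
    rw [Term.realize_relabel]
    congr 1
    funext a
    exact a.2.choose_spec
  · rintro ⟨t, rfl⟩
    exact t.realize_mem _ fun a => Substructure.subset_closure (mem_range_self a)

/-- An element named by a term at `u` goes to the value of that term at `v`. The two directions of
`SameTerms` give well-definedness and injectivity; there are no relations to respect. -/
theorem SameTerms.exists_embedding [L.IsAlgebraic] {u : α → M} {v : α → N}
    (h : SameTerms L u v) : ∃ g : Substructure.closure L (range u) ↪[L] N,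
      ∀ (x : Substructure.closure L (range u)) (t : L.Term α), t.realize u = x →
        g x = t.realize v := by
  choose τ hτ using fun x : Substructure.closure L (range u) => mem_closure_range_iff.1 x.2
  have key : ∀ (x : Substructure.closure L (range u)) (t : L.Term α), t.realize u = x →
      (τ x).realize v = t.realize v := fun x t ht => (h _ _).1 ((hτ x).trans ht.symm)
  refine ⟨⟨⟨fun x => (τ x).realize v, fun x y hxy => ?_⟩, fun {n} f xs => ?_,
    fun {n} r => isEmptyElim r⟩, key⟩
  · apply Subtype.ext
    rw [← hτ x, ← hτ y]
    exact (h _ _).2 hxy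
  · refine (key _ (Term.func f fun i => τ (xs i)) ?_).trans rfl
    simp only [Term.realize_func, hτ]
    rfl

theorem SameTerms.exists_automorphism [L.IsAlgebraic] [Finite α] (hM : L.IsUltrahomogeneous M)
    {u v : α → M} (h : SameTerms L u v) : ∃ g : M ≃[L] M, ∀ a, g (u a) = v a := by
  obtain ⟨e, he⟩ := h.exists_embedding
  obtain ⟨g, hg⟩ := hM _ (Substructure.fg_closure (finite_range u)) e
  refine ⟨g, fun a => ?_⟩
  have h1 := he ⟨u a, Substructure.subset_closure (mem_range_self a)⟩ (Term.var a) rfl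
  rw [hg] at h1
  exact h1

/-- Up to equality in `M`, there are only finitely many terms in a given finite set of variables. -/
def FinitelyManyTerms (L : FirstOrder.Language.{0, 0}) (M : Type*) [L.Structure M] : Prop :=
  ∀ (α : Type) [Finite α], (range fun (t : L.Term α) (v : α → M) => t.realize v).Finite

/-- The terms `τ i` represent all terms in `M`. -/
def Represents (M : Type*) [L.Structure M] {ι : Type*} (τ : ι → L.Term α) : Prop :=
  ∀ t : L.Term α, ∃ i, ∀ v : α → M, t.realize v = (τ i).realize v

theorem FinitelyManyTerms.exists_represents (h : FinitelyManyTerms L M) (α : Type) [Finite α] :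
    ∃ (n : ℕ) (τ : Fin n → L.Term α), Represents M τ := by
  have := (h α).to_subtype
  obtain ⟨n, ⟨e⟩⟩ := Finite.exists_equiv_fin (range fun (t : L.Term α) (v : α → M) => t.realize v)
  refine ⟨n, fun i => (e.symm i).2.choose, fun t => ⟨e ⟨_, t, rfl⟩, fun v => ?_⟩⟩
  have := (e.symm (e ⟨_, t, rfl⟩)).2.choose_spec
  have h2 := congrFun this v
  simp only [Equiv.symm_apply_apply] at h2 ⊢
  exact h2.symm

variable {ι : Type}

/-- The equations between the terms `τ i` which hold for a tuple. -/
def pattern (τ : ι → L.Term α) (v : α → M) : Set (ι × ι) :=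
  {p | (τ p.1).realize v = (τ p.2).realize v}

/-- This replaces infinitely many equations by a finite pattern when `ι` is finite. Since identities
of `M` hold in `N`, representatives chosen for `M` also serve for `N`. -/
theorem sameTerms_iff_pattern_eq {τ : ι → L.Term α} (hM : Represents M τ)
    (hMN : ∀ t s : L.Term α, (∀ v : α → M, t.realize v = s.realize v) →
      ∀ v : α → N, t.realize v = s.realize v) {u : α → M} {v : α → N} :
    SameTerms L u v ↔ pattern τ u = pattern τ v := by
  constructor
  · intro h
    ext p
    exact h _ _
  · intro h t s
    obtain ⟨i, hi⟩ := hM t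
    obtain ⟨j, hj⟩ := hM s
    rw [hi, hj, hMN _ _ hi, hMN _ _ hj]
    exact Set.ext_iff.1 h (i, j)

open Classical in
/-- The quantifier-free formula saying that a tuple has a given pattern. -/
noncomputable def patternFormula [Finite ι] (τ : ι → L.Term α) (S : Set (ι × ι)) : L.Formula α :=
  Formula.iInf fun p : ι × ι =>
    if p ∈ S then (τ p.1).equal (τ p.2) else ((τ p.1).equal (τ p.2)).not

theorem realize_patternFormula [Finite ι] {τ : ι → L.Term α} {S : Set (ι × ι)} {v : α → M} :
    (patternFormula τ S).Realize v ↔ pattern τ v = S := by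
  rw [patternFormula, Formula.realize_iInf, Set.ext_iff]
  refine forall_congr' fun p => ?_
  split_ifs with h <;> simp [h, pattern, Formula.realize_equal]

theorem isQF_foldr_sup {n : ℕ} (l : List (L.BoundedFormula α n)) (h : ∀ φ ∈ l, φ.IsQF) :
    (l.foldr (· ⊔ ·) ⊥).IsQF := by
  induction l with
  | nil => exact BoundedFormula.isQF_bot
  | cons a l ih =>
    exact (h a (by simp)).sup (ih fun φ hφ => h φ (by simp [hφ]))

theorem isQF_foldr_inf {n : ℕ} (l : List (L.BoundedFormula α n)) (h : ∀ φ ∈ l, φ.IsQF) :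
    (l.foldr (· ⊓ ·) ⊤).IsQF := by
  induction l with
  | nil => exact BoundedFormula.IsQF.top
  | cons a l ih =>
    exact (h a (by simp)).inf (ih fun φ hφ => h φ (by simp [hφ]))

theorem isQF_iSup {β : Type*} [Finite β] (f : β → L.Formula α)
    (h : ∀ b, BoundedFormula.IsQF (f b)) : BoundedFormula.IsQF (Formula.iSup f) := by
  refine isQF_foldr_sup _ fun φ hφ => ?_
  obtain ⟨b, -, rfl⟩ := List.mem_map.1 hφ
  exact h b

theorem isQF_iInf {β : Type*} [Finite β] (f : β → L.Formula α)
    (h : ∀ b, BoundedFormula.IsQF (f b)) : BoundedFormula.IsQF (Formula.iInf f) := by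
  refine isQF_foldr_inf _ fun φ hφ => ?_
  obtain ⟨b, -, rfl⟩ := List.mem_map.1 hφ
  exact h b

theorem isQF_patternFormula [Finite ι] (τ : ι → L.Term α) (S : Set (ι × ι)) :
    BoundedFormula.IsQF (patternFormula τ S) := by
  refine isQF_iInf _ fun p => ?_
  have h := (BoundedFormula.IsAtomic.equal ((τ p.1).relabel Sum.inl)
    ((τ p.2).relabel (Sum.inl : α → α ⊕ Fin 0))).isQF
  split_ifs
  exacts [h, h.not]

/-- Tuples with the same pattern are conjugate under automorphisms, so the truth of `φ` depends only
on the pattern, and `φ` is a finite disjunction of pattern formulas. -/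
theorem exists_isQF_of_isUltrahomogeneous [L.IsAlgebraic] (hM : L.IsUltrahomogeneous M)
    (hT : FinitelyManyTerms L M) [Finite α] (φ : L.Formula α) :
    ∃ ψ : L.Formula α, BoundedFormula.IsQF ψ ∧ ∀ v : α → M, φ.Realize v ↔ ψ.Realize v := by
  obtain ⟨n, τ, hτ⟩ := hT.exists_represents α
  refine ⟨Formula.iSup fun S : {S : Set (Fin n × Fin n) //
      ∃ v : α → M, φ.Realize v ∧ pattern τ v = S} => patternFormula τ S.1,
    isQF_iSup _ fun S => isQF_patternFormula τ _, fun v => ?_⟩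
  rw [Formula.realize_iSup]
  simp only [realize_patternFormula]
  constructor
  · intro h
    exact ⟨⟨pattern τ v, v, h, rfl⟩, rfl⟩
  · rintro ⟨⟨S, u, hu, rfl⟩, hv⟩
    have hs : SameTerms L u v :=
      (sameTerms_iff_pattern_eq hτ (fun _ _ h => h)).2 hv.symm
    obtain ⟨g, hg⟩ := hs.exists_automorphism hM
    have : v = g ∘ u := funext fun a => (hg a).symm
    rw [this, StrongHomClass.realize_formula]
    exact hu

theorem ElementarilyEquivalent.forall_realize (h : M ≅[L] N) [Finite α] {φ : L.Formula α}
    (hφ : ∀ v : α → M, φ.Realize v) (v : α → N) : φ.Realize v := by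
  have h1 := h.realize_sentence (Formula.iAlls α (φ.relabel (Sum.inr : α → Empty ⊕ α)))
  simp only [Sentence.Realize, Formula.realize_iAlls, Formula.realize_relabel] at h1
  exact h1.1 (fun i => hφ i) v

theorem ElementarilyEquivalent.realize_term_eq (h : M ≅[L] N) [Finite α] (t s : L.Term α)
    (hts : ∀ v : α → M, t.realize v = s.realize v) (v : α → N) : t.realize v = s.realize v := by
  have := ElementarilyEquivalent.forall_realize h (φ := t.equal s)
    (fun v => Formula.realize_equal.2 (hts v)) v
  exact Formula.realize_equal.1 this

theorem ElementarilyEquivalent.represents (h : M ≅[L] N) [Finite α] {τ : ι → L.Term α}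
    (hτ : Represents M τ) : Represents N τ := fun t =>
  let ⟨i, hi⟩ := hτ t
  ⟨i, ElementarilyEquivalent.realize_term_eq h _ _ hi⟩

theorem SameTerms.realize_isQF [L.IsAlgebraic] {u : α → M} {v : α → N} (h : SameTerms L u v) {n : ℕ}
    {ψ : L.BoundedFormula α n} (hψ : ψ.IsQF) (hn : n = 0) (x : Fin n → M) (y : Fin n → N) :
    ψ.Realize u x ↔ ψ.Realize v y := by
  subst hn
  induction hψ with
  | falsum => exact Iff.rfl
  | imp _ _ h1 h2 => exact imp_congr h1 h2
  | of_isAtomic ha =>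
    cases ha with
    | rel R _ => exact isEmptyElim R
    | equal t s =>
      have e1 : Sum.elim u x = u ∘ Sum.elim id Fin.elim0 := by
        ext i; rcases i with i | i; exacts [rfl, i.elim0]
      have e2 : Sum.elim v y = v ∘ Sum.elim id Fin.elim0 := by
        ext i; rcases i with i | i; exacts [rfl, i.elim0]
      rw [BoundedFormula.realize_bdEqual, BoundedFormula.realize_bdEqual, e1, e2]
      simp only [← Term.realize_relabel]
      exact h _ _

/-- Tuples with the same equations, in models of the theory of an ultrahomogeneous structure,
have the same one-point extensions. -/
theorem SameTerms.exists_extend [L.IsAlgebraic] (hM : L.IsUltrahomogeneous M)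
    (hT : FinitelyManyTerms L M) (hN : M ≅[L] N) (hP : M ≅[L] P) [Finite α] {u : α → N} {v : α → P}
    (h : SameTerms L u v) (m : N) :
    ∃ p : P, SameTerms L (Sum.elim u fun _ : Unit => m) (Sum.elim v fun _ : Unit => p) := by
  obtain ⟨n, τ, hτ⟩ := hT.exists_represents (α ⊕ Unit)
  have hτN := ElementarilyEquivalent.represents hN hτ
  -- Eliminate the quantifier from "some point extends the tuple with this pattern". The equivalence
  -- is first-order, so it passes from `M` to `N` and `P`, where `u` and `v` agree on
  -- quantifier-free formulas.
  obtain ⟨ψ, hψ, hψM⟩ := exists_isQF_of_isUltrahomogeneous hM hT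
    (Formula.iExs Unit (patternFormula τ (pattern τ (Sum.elim u fun _ : Unit => m))))
  set φ := Formula.iExs Unit (patternFormula τ (pattern τ (Sum.elim u fun _ : Unit => m))) with hφ
  have hiff : ∀ v : α → M, (Formula.iff φ ψ).Realize v := fun v => Formula.realize_iff.2 (hψM v)
  have hψN := fun v => Formula.realize_iff.1 (ElementarilyEquivalent.forall_realize hN hiff v)
  have hψP := fun v => Formula.realize_iff.1 (ElementarilyEquivalent.forall_realize hP hiff v)
  have h1 : φ.Realize u := by
    rw [hφ, Formula.realize_iExs]
    exact ⟨fun _ => m, realize_patternFormula.2 rfl⟩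
  have h2 : φ.Realize v :=
    (hψP v).2 ((h.realize_isQF hψ rfl _ _).1 ((hψN u).1 h1))
  rw [hφ, Formula.realize_iExs] at h2
  obtain ⟨p, hp⟩ := h2
  refine ⟨p (), ?_⟩
  rw [sameTerms_iff_pattern_eq hτN
    (ElementarilyEquivalent.realize_term_eq (hN.symm.trans hP))]
  exact (realize_patternFormula.1 hp).symm

theorem isExtensionPair_of_sameTerms [L.IsAlgebraic]
    (h : ∀ (n : ℕ) (u : Fin n → M) (v : Fin n → N), SameTerms L u v → ∀ m : M,
      ∃ p : N, SameTerms L (Sum.elim u fun _ : Unit => m) (Sum.elim v fun _ : Unit => p)) :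
    L.IsExtensionPair M N := by
  rw [isExtensionPair_iff_exists_embedding_closure_singleton_sup]
  intro S hS f m
  obtain ⟨n, u, hu⟩ := Substructure.fg_iff_exists_fin_generating_family.1 hS
  have huS : ∀ i, u i ∈ S := fun i => hu ▸ Substructure.subset_closure (mem_range_self i)
  set u' : Fin n → S := fun i => ⟨u i, huS i⟩ with hu'
  have hfu : ∀ t : L.Term (Fin n), t.realize (fun i => f (u' i)) = f (t.realize u') := fun t =>
    HomClass.realize_term f
  have huu : ∀ t : L.Term (Fin n), t.realize u = ((t.realize u' : S) : M) := fun t =>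
    HomClass.realize_term S.subtype (v := u')
  have hs : SameTerms L u fun i => f (u' i) := by
    intro t s
    rw [hfu, hfu, huu, huu, f.injective.eq_iff, Subtype.ext_iff]
  obtain ⟨p, hp⟩ := h n u _ hs m
  obtain ⟨g, hg⟩ := hp.exists_embedding
  have hle : (Substructure.closure L {m} ⊔ S : L.Substructure M) ≤
      Substructure.closure L (range (Sum.elim u fun _ : Unit => m)) := by
    rw [← hu, ← Substructure.closure_union]
    refine Substructure.closure_mono ?_
    rintro x (rfl | ⟨i, rfl⟩)
    exacts [⟨Sum.inr (), rfl⟩, ⟨Sum.inl i, rfl⟩]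
  refine ⟨g.comp (Substructure.inclusion hle), ?_⟩
  ext x
  obtain ⟨t, ht⟩ := mem_closure_range_iff.1 (show (x : M) ∈ Substructure.closure L (range u) by
    rw [hu]; exact x.2)
  have := hg (Substructure.inclusion hle (Substructure.inclusion le_sup_right x))
    (t.relabel Sum.inl) (by rw [Term.realize_relabel]; exact ht)
  rw [Embedding.comp_apply, Embedding.comp_apply, this, Term.realize_relabel, Sum.elim_comp_inl, hfu]
  congr 1
  exact Subtype.ext (ht.symm.trans (huu t))

theorem nonempty_equiv_of_elementarilyEquivalent [L.IsAlgebraic] [Countable (Σ n, L.Functions n)]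
    (hM : L.IsUltrahomogeneous M) (hT : FinitelyManyTerms L M) (hN : M ≅[L] N) (hP : M ≅[L] P)
    [Countable N] [Countable P] : Nonempty (N ≃[L] P) := by
  have hs : SameTerms L (Fin.elim0 : Fin 0 → N) (Fin.elim0 : Fin 0 → P) := by
    intro t s
    have e := (hN.symm.trans hP).realize_sentence
      ((t.relabel fun i => i.elim0).equal (s.relabel fun i => i.elim0) : L.Sentence)
    simp only [Sentence.Realize, Formula.realize_equal, Term.realize_relabel] at e
    convert e using 3
  obtain ⟨g, -⟩ := hs.exists_embedding
  obtain ⟨f, -⟩ := equiv_between_cg (L := L) (M := N) (N := P) Structure.cg_of_countable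
    Structure.cg_of_countable
    ⟨⟨_, _, g.equivRange⟩, Substructure.fg_closure (finite_range _)⟩
    (isExtensionPair_of_sameTerms fun n u v h m => h.exists_extend hM hT hN hP m)
    (isExtensionPair_of_sameTerms fun n u v h m => h.exists_extend hM hT hP hN m)
  exact ⟨f⟩

theorem isOmegaCategorical_of_isUltrahomogeneous [L.IsAlgebraic] [Countable (Σ n, L.Functions n)]
    (M : Type u) [L.Structure M] [Countable M] [Infinite M]
    (hM : L.IsUltrahomogeneous M) (hT : FinitelyManyTerms L M) : IsOmegaCategorical L M := by
  refine ⟨inferInstance, inferInstance, fun N P hN hP => ?_⟩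
  have : Countable N := Cardinal.mk_le_aleph0_iff.1 hN.le
  have : Countable P := Cardinal.mk_le_aleph0_iff.1 hP.le
  have key : ∀ Q : (L.completeTheory M).ModelType, M ≅[L] Q := fun Q =>
    elementarilyEquivalent_iff.2 fun φ => (realize_iff_of_model_completeTheory M Q φ).symm
  exact nonempty_equiv_of_elementarilyEquivalent hM hT (key N) (key P)

theorem hasQuantifierElimination_of_isUltrahomogeneous [L.IsAlgebraic]
    (M : Type u) [L.Structure M]
    (hM : L.IsUltrahomogeneous M) (hT : FinitelyManyTerms L M) : HasQuantifierElimination L M :=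
  fun _ φ => exists_isQF_of_isUltrahomogeneous hM hT φ

end ModelTheory

/-! ### Group terms, graphs of partial isomorphisms, and local finiteness. -/

section Groups

instance : groupLang.IsAlgebraic := fun _ => inferInstanceAs (IsEmpty Empty)

variable {G H : Type*} [Group G] [Group H] {α : Type}

/-- The term for the product of two terms. -/
def mulTerm (t s : groupLang.Term α) : groupLang.Term α :=
  Term.func (GroupFunc.mul : groupLang.Functions 2) ![t, s]

/-- The term for the inverse of a term. -/
def invTerm (t : groupLang.Term α) : groupLang.Term α :=
  Term.func (GroupFunc.inv : groupLang.Functions 1) ![t]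

/-- The term for the unit. -/
def oneTerm : groupLang.Term α :=
  Term.func (GroupFunc.one : groupLang.Functions 0) Fin.elim0

theorem groupTerm_induction {p : groupLang.Term α → Prop} (var : ∀ a, p (Term.var a))
    (one : p oneTerm) (inv : ∀ t, p t → p (invTerm t))
    (mul : ∀ t s, p t → p s → p (mulTerm t s)) (t : groupLang.Term α) : p t := by
  induction t with
  | var a => exact var a
  | @func n f ts ih =>
    change GroupFunc n at f
    cases f with
    | one =>
      have : ts = Fin.elim0 := Subsingleton.elim _ _
      rw [this]; exact one
    | inv =>
      have : ts = ![ts 0] := by ext i; fin_cases i; rfl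
      rw [this]; exact inv _ (ih 0)
    | mul =>
      have : ts = ![ts 0, ts 1] := by ext i; fin_cases i <;> rfl
      rw [this]; exact mul _ _ (ih 0) (ih 1)

/-- A subgroup of a product is the graph of an isomorphism between subgroups of the factors. -/
def IsGraph (Γ : Subgroup (G × H)) : Prop := ∀ p ∈ Γ, p.1 = 1 ↔ p.2 = 1

theorem IsGraph.fst_eq_iff {Γ : Subgroup (G × H)} (hΓ : IsGraph Γ) {p q : G × H} (hp : p ∈ Γ)
    (hq : q ∈ Γ) : p.1 = q.1 ↔ p.2 = q.2 := by
  have := hΓ _ (mul_mem hp (inv_mem hq))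
  simpa [mul_inv_eq_one] using this

theorem IsGraph.eq_of_fst {Γ : Subgroup (G × H)} (hΓ : IsGraph Γ) {p q : G × H} (hp : p ∈ Γ)
    (hq : q ∈ Γ) (h : p.1 = q.1) : p = q :=
  Prod.ext h ((hΓ.fst_eq_iff hp hq).1 h)

theorem IsGraph.eq_of_snd {Γ : Subgroup (G × H)} (hΓ : IsGraph Γ) {p q : G × H} (hp : p ∈ Γ)
    (hq : q ∈ Γ) (h : p.2 = q.2) : p = q :=
  Prod.ext ((hΓ.fst_eq_iff hp hq).2 h) h

theorem IsGraph.sameTerms {Γ : Subgroup (G × H)} (hΓ : IsGraph Γ) {u : α → G} {v : α → H}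
    (h : ∀ a, (u a, v a) ∈ Γ) : SameTerms groupLang u v := by
  have key : ∀ t : groupLang.Term α, (t.realize u, t.realize v) ∈ Γ :=
    groupTerm_induction h Γ.one_mem (fun _ h => inv_mem h) (fun _ _ h1 h2 => mul_mem h1 h2)
  exact fun t s => hΓ.fst_eq_iff (key t) (key s)

theorem SameTerms.isGraph {u : α → G} {v : α → H} (h : SameTerms groupLang u v) :
    IsGraph (Subgroup.closure (range fun a => (u a, v a))) := by
  intro p hp
  have key : ∃ t : groupLang.Term α, p = (t.realize u, t.realize v) := by
    induction hp using Subgroup.closure_induction with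
    | mem x hx => obtain ⟨a, rfl⟩ := hx; exact ⟨Term.var a, rfl⟩
    | one => exact ⟨oneTerm, rfl⟩
    | mul x y _ _ hx hy =>
      obtain ⟨t, rfl⟩ := hx; obtain ⟨s, rfl⟩ := hy; exact ⟨mulTerm t s, rfl⟩
    | inv x _ hx => obtain ⟨t, rfl⟩ := hx; exact ⟨invTerm t, rfl⟩
  obtain ⟨t, rfl⟩ := key
  exact h t oneTerm

/-- Groups of exponent dividing four in which all involutions are central. -/
structure CentralInvolutions (G : Type*) [Group G] : Prop where
  pow_four : ∀ x : G, x ^ 4 = 1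
  comm : ∀ x : G, x ^ 2 = 1 → ∀ y, x * y = y * x

/-- Modulo the centre all squares vanish, so the quotient is abelian and finite. The centre then has
finite index, hence is finitely generated, abelian and torsion. -/
theorem finite_of_pow_four_of_sq_comm (K : Type*) [Group K] [Group.FG K]
    (h4 : ∀ x : K, x ^ 4 = 1) (hc : ∀ x y : K, x ^ 2 * y = y * x ^ 2) : Finite K := by
  have hsq : ∀ x : K ⧸ Subgroup.center K, x ^ 2 = 1 := by
    intro x
    obtain ⟨x, rfl⟩ := QuotientGroup.mk_surjective x
    rw [← QuotientGroup.mk_pow, QuotientGroup.eq_one_iff, Subgroup.mem_center_iff]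
    exact fun y => (hc x y).symm
  have hinv : ∀ x : K ⧸ Subgroup.center K, x⁻¹ = x := fun x => by
    rw [inv_eq_iff_mul_eq_one, ← sq, hsq]
  let _ : CommGroup (K ⧸ Subgroup.center K) :=
    { (inferInstance : Group (K ⧸ Subgroup.center K)) with
      mul_comm := fun x y => by rw [← hinv (x * y), mul_inv_rev, hinv, hinv] }
  have : Finite (K ⧸ Subgroup.center K) := CommGroup.finite_of_fg_isMulTorsion _ fun x =>
    isOfFinOrder_iff_pow_eq_one.2 ⟨2, by norm_num, hsq x⟩
  have : (Subgroup.center K).FiniteIndex := Subgroup.finiteIndex_of_finite_quotient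
  let _ : CommGroup (Subgroup.center K) :=
    { (inferInstance : Group (Subgroup.center K)) with
      mul_comm := fun x y => Subtype.ext (Subgroup.mem_center_iff.1 y.2 x) }
  have : Finite (Subgroup.center K) := CommGroup.finite_of_fg_isMulTorsion _ fun x =>
    isOfFinOrder_iff_pow_eq_one.2 ⟨4, by norm_num, Subtype.ext (h4 x)⟩
  exact Finite.of_subgroup_quotient (Subgroup.center K)

theorem finite_closure_of_pow_four_of_sq_comm {K : Type*} [Group K]
    (h4 : ∀ x : K, x ^ 4 = 1) (hc : ∀ x y : K, x ^ 2 * y = y * x ^ 2) {s : Set K} (hs : s.Finite) :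
    Finite (Subgroup.closure s) := by
  have : Group.FG (Subgroup.closure s) := by
    have := hs.to_subtype
    exact Group.closure_finite_fg s
  exact finite_of_pow_four_of_sq_comm _ (fun x => Subtype.ext (h4 x)) fun x y => Subtype.ext (hc x y)

namespace CentralInvolutions

theorem sq_comm (hG : CentralInvolutions G) (x y : G) : x ^ 2 * y = y * x ^ 2 :=
  hG.comm _ (by rw [← pow_mul]; exact hG.pow_four x) y

/-- Term functions lie in the subgroup of the power `(α → G) → G` generated by the finitely many
projections, and the power satisfies the same laws. -/
theorem finitelyManyTerms (hG : CentralInvolutions G) : FinitelyManyTerms groupLang G := by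
  intro α _
  have hfin : Finite (Subgroup.closure (range fun (a : α) (v : α → G) => v a)) :=
    finite_closure_of_pow_four_of_sq_comm (fun x => funext fun v => hG.pow_four _)
      (fun x y => funext fun v => hG.sq_comm _ _) (finite_range _)
  refine (Set.toFinite (Subgroup.closure (range fun (a : α) (v : α → G) => v a) :
    Set ((α → G) → G))).subset ?_
  rintro _ ⟨t, rfl⟩
  refine groupTerm_induction (p := fun t => (fun v : α → G => t.realize v) ∈
    Subgroup.closure (range fun (a : α) (v : α → G) => v a)) (fun a => ?_) ?_ ?_ ?_ t
  · exact Subgroup.subset_closure ⟨a, rfl⟩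
  · exact one_mem _
  · exact fun t h => inv_mem h
  · exact fun t s h1 h2 => mul_mem h1 h2

theorem of_injective (hH : CentralInvolutions H) (f : G →* H) (hf : Function.Injective f) :
    CentralInvolutions G where
  pow_four x := hf (by rw [map_pow, hH.pow_four, map_one])
  comm x hx y := hf (by rw [map_mul, map_mul, hH.comm _ (by rw [← map_pow, hx, map_one])])

theorem finite_graph (hG : CentralInvolutions G) (hH : CentralInvolutions H) {s : Set (G × H)}
    (hs : s.Finite) : Finite (Subgroup.closure s) :=
  finite_closure_of_pow_four_of_sq_comm (fun _ => Prod.ext (hG.pow_four _) (hH.pow_four _))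
    (fun _ _ => Prod.ext (hG.sq_comm _ _) (hH.sq_comm _ _)) hs

end CentralInvolutions

/-- An embedding of structures in the language of groups, as a group homomorphism. -/
def homOfEmbedding (f : G ↪[groupLang] H) : G →* H where
  toFun := f
  map_one' := f.map_fun (GroupFunc.one : groupLang.Functions 0) Fin.elim0
  map_mul' x y := f.map_fun (GroupFunc.mul : groupLang.Functions 2) ![x, y]

/-- An isomorphism of structures in the language of groups, as a group isomorphism. -/
def mulEquivOfEquiv (f : G ≃[groupLang] H) : G ≃* H :=
  { f.toEquiv with
    map_mul' := fun x y => f.map_fun (GroupFunc.mul : groupLang.Functions 2) ![x, y] }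

/-- A group homomorphism, as a homomorphism of structures in the language of groups. -/
def structureHom (f : G →* H) : G →[groupLang] H where
  toFun := f
  map_fun' {n} g xs := by
    change GroupFunc n at g
    cases g with
    | one => exact map_one f
    | inv => exact map_inv f _
    | mul => exact map_mul f _ _
  map_rel' {_} r := isEmptyElim r

end Groups

/-! ### Rich groups and one-point extension of finite partial isomorphisms. -/

section Rich

variable {G H : Type*} [Group G] [Group H]

/-- Groups of exponent four with central involutions in which all consistent one-element extensions
of finite subgroups are realized. -/
structure IsRich (G : Type*) [Group G] : Prop extends CentralInvolutions G where
  infinite_involutions : {z : G | z ^ 2 = 1}.Infinite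
  -- Here `w` is the desired square of `y` and `f a` the desired commutator of `y` and `a`. The
  -- inequality says that `y * a` must not square to `1`; such extensions come from adjoining an
  -- involution instead.
  exists_extension : ∀ (A : Subgroup G) [Finite A] (w : G) (f : A →* G), w ^ 2 = 1 →
    (∀ a, f a ^ 2 = 1) → (∀ a : A, a ^ 2 = 1 → f a = 1) → (∀ a : A, w * f a * (a : G) ^ 2 ≠ 1) →
    ∃ y : G, y ^ 2 = w ∧ ∀ a : A, y * a = f a * a * y

/-- As `g` normalises `Γ` and its square lies in `Γ`, the union of `Γ` and one further coset is a
subgroup. -/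
theorem Subgroup.exists_adjoin {K : Type*} [Group K] (Γ : Subgroup K) (g : K) (hg : g * g ∈ Γ)
    (hn : ∀ p ∈ Γ, g * p * g⁻¹ ∈ Γ) :
    ∃ Γ' : Subgroup K, Γ ≤ Γ' ∧ g ∈ Γ' ∧ ∀ x ∈ Γ', x ∈ Γ ∨ x * g ∈ Γ := by
  have hn' : ∀ p ∈ Γ, g⁻¹ * p * g ∈ Γ := fun p hp => by
    have := mul_mem (mul_mem (inv_mem hg) (hn p hp)) hg
    convert this using 1
    group
  refine ⟨⟨⟨⟨{x | x ∈ Γ ∨ x * g ∈ Γ}, ?_⟩, Or.inl Γ.one_mem⟩, ?_⟩, fun x hx => Or.inl hx,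
    Or.inr hg, fun x hx => hx⟩
  · rintro x y (hx | hx) (hy | hy)
    · exact Or.inl (mul_mem hx hy)
    · exact Or.inr (by rw [mul_assoc]; exact mul_mem hx hy)
    · refine Or.inr ?_
      convert mul_mem hx (hn' y hy) using 1
      group
    · refine Or.inl ?_
      convert mul_mem (mul_mem hx (hn' _ hy)) (inv_mem hg) using 1
      group
  · rintro x (hx | hx)
    · exact Or.inl (inv_mem hx)
    · refine Or.inr ?_
      convert mul_mem (hn _ (inv_mem hx)) hg using 1
      group

theorem IsGraph.exists_adjoin {Γ : Subgroup (H × G)} (hΓ : IsGraph Γ) [Finite Γ] {m : H} {y : G}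
    (hg : (m, y) * (m, y) ∈ Γ) (hn : ∀ p ∈ Γ, (m, y) * p * (m, y)⁻¹ ∈ Γ)
    (hm : ∀ p ∈ Γ, p.1 ≠ m) (hy : ∀ p ∈ Γ, p.2 ≠ y) :
    ∃ Γ' : Subgroup (H × G), Γ ≤ Γ' ∧ IsGraph Γ' ∧ Finite Γ' ∧ (m, y) ∈ Γ' ∧
      ∀ x ∈ Γ', x ∈ Γ ∨ x * (m, y) ∈ Γ := by
  obtain ⟨Γ', hle, hmem, h⟩ := Subgroup.exists_adjoin Γ (m, y) hg hn
  refine ⟨Γ', hle, fun p hp => ?_, ?_, hmem, h⟩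
  · rcases h p hp with h1 | h1
    · exact hΓ p h1
    · refine iff_of_false (fun e => hm _ h1 ?_) (fun e => hy _ h1 ?_) <;> simp [e]
  · refine Set.Finite.to_subtype (s := (Γ' : Set (H × G))) (Set.Finite.subset
      ((Set.toFinite (Γ : Set (H × G))).union
        ((Set.toFinite (Γ : Set (H × G))).image (· * (m, y)⁻¹))) fun x hx => ?_)
    rcases h x hx with h1 | h1
    · exact Or.inl h1
    · exact Or.inr ⟨_, h1, mul_inv_cancel_right _ _⟩

/-- If `m` is new, pair it with an involution outside the finite range; both are central. The last
clause records that the domain grows only by involutions. -/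
theorem IsGraph.exists_extend_involution (hH : CentralInvolutions H) (hG : IsRich G)
    {Γ : Subgroup (H × G)} (hΓ : IsGraph Γ) [Finite Γ] {m : H} (hm : m ^ 2 = 1) :
    ∃ Γ' : Subgroup (H × G), Γ ≤ Γ' ∧ IsGraph Γ' ∧ Finite Γ' ∧ (∃ y, (m, y) ∈ Γ') ∧
      ∀ x ∈ Γ', ∃ p ∈ Γ, (x.1 * p.1⁻¹) ^ 2 = 1 := by
  by_cases hex : ∃ p ∈ Γ, p.1 = m
  · obtain ⟨p, hp, rfl⟩ := hex
    exact ⟨Γ, le_rfl, hΓ, ‹_›, ⟨p.2, hp⟩, fun x hx => ⟨x, hx, by simp⟩⟩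
  push Not at hex
  obtain ⟨z, hz, hzΓ⟩ := hG.infinite_involutions.exists_notMem_finite
    ((Set.toFinite (Γ : Set (H × G))).image Prod.snd)
  have hsq : (m, z) * (m, z) = 1 := by
    rw [← sq]; exact Prod.ext hm hz
  obtain ⟨Γ', hle, hgr, hfin, hmem, h⟩ := hΓ.exists_adjoin (m := m) (y := z)
    (by rw [hsq]; exact one_mem _) (fun p hp => by
      have : (m, z) * p = p * (m, z) := Prod.ext (hH.comm m hm p.1) (hG.comm z hz p.2)
      rw [this, mul_inv_cancel_right]; exact hp) hex
    (fun p hp e => hzΓ ⟨p, hp, e⟩)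
  refine ⟨Γ', hle, hgr, hfin, ⟨z, hmem⟩, fun x hx => ?_⟩
  rcases h x hx with h1 | h1
  · exact ⟨x, h1, by simp⟩
  · refine ⟨_, h1, ?_⟩
    have : x.1 * (x * (m, z)).1⁻¹ = x.1 * m⁻¹ * x.1⁻¹ := by simp [mul_assoc]
    rw [this, conj_pow, inv_pow, hm]
    simp

theorem IsGraph.exists_extend_involutions (hH : CentralInvolutions H) (hG : IsRich G)
    {Γ : Subgroup (H × G)} (hΓ : IsGraph Γ) [Finite Γ] {S : Set H} (hS : S.Finite)
    (hinv : ∀ m ∈ S, m ^ 2 = 1) :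
    ∃ Γ' : Subgroup (H × G), Γ ≤ Γ' ∧ IsGraph Γ' ∧ Finite Γ' ∧ (∀ m ∈ S, ∃ y, (m, y) ∈ Γ') ∧
      ∀ x ∈ Γ', ∃ p ∈ Γ, (x.1 * p.1⁻¹) ^ 2 = 1 := by
  induction S, hS using Set.Finite.induction_on with
  | empty => exact ⟨Γ, le_rfl, hΓ, ‹_›, by simp, fun x hx => ⟨x, hx, by simp⟩⟩
  | @insert a S _ _ ih =>
    obtain ⟨Γ₁, h1, g1, f1, m1, e1⟩ := ih fun m hm => hinv m (Or.inr hm)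
    obtain ⟨Γ₂, h2, g2, f2, m2, e2⟩ := g1.exists_extend_involution hH hG (hinv a (Or.inl rfl))
    refine ⟨Γ₂, h1.trans h2, g2, f2, ?_, fun x hx => ?_⟩
    · rintro m (rfl | hm)
      · exact m2
      · obtain ⟨y, hy⟩ := m1 m hm
        exact ⟨y, h2 hy⟩
    · obtain ⟨p, hp, hxp⟩ := e2 x hx
      obtain ⟨q, hq, hpq⟩ := e1 p hp
      refine ⟨q, hq, ?_⟩
      have : x.1 * q.1⁻¹ = (x.1 * p.1⁻¹) * (p.1 * q.1⁻¹) := by group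
      rw [this, (show Commute _ _ from hH.comm _ hxp _).mul_pow, hxp, hpq, one_mul]

namespace CentralInvolutions

theorem commutator_sq (hH : CentralInvolutions H) (x y : H) : (x * y * x⁻¹ * y⁻¹) ^ 2 = 1 := by
  have e : x * y * x⁻¹ * y⁻¹ = x ^ 2 * ((x⁻¹ * y) ^ 2 * y⁻¹ ^ 2) := by
    simp only [sq]; group
  have h4 : ∀ z : H, (z ^ 2) ^ 2 = 1 := fun z => by rw [← pow_mul]; exact hH.pow_four z
  rw [e, (show Commute _ _ from hH.sq_comm x _).mul_pow,
    (show Commute _ _ from hH.sq_comm (x⁻¹ * y) _).mul_pow, h4, h4, h4, one_mul, one_mul]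

/-- Commutators square to `1` and so are central, which makes them multiplicative in each argument.
-/
theorem commutator_mul (hH : CentralInvolutions H) (m x y : H) :
    m * (x * y) * m⁻¹ * (x * y)⁻¹ = (m * x * m⁻¹ * x⁻¹) * (m * y * m⁻¹ * y⁻¹) := by
  rw [mul_assoc (m * x * m⁻¹) x⁻¹, ← hH.comm _ (hH.commutator_sq m y) x⁻¹]
  group

theorem mul_sq (hH : CentralInvolutions H) (m x : H) :
    (m * x) ^ 2 = m ^ 2 * (m * x * m⁻¹ * x⁻¹) * x ^ 2 := by
  have h1 := hH.commutator_sq m x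
  have h2 : m * x * m⁻¹ * x⁻¹ = x * m * x⁻¹ * m⁻¹ := by
    rw [sq, mul_eq_one_iff_eq_inv] at h1
    rw [h1]; group
  rw [sq m, mul_assoc m m, ← hH.comm _ h1 m, h2]
  simp only [sq]; group

end CentralInvolutions

theorem IsGraph.exists_extend (hH : CentralInvolutions H) (hG : IsRich G)
    {Γ : Subgroup (H × G)} (hΓ : IsGraph Γ) [Finite Γ] (m : H) :
    ∃ Γ' : Subgroup (H × G), Γ ≤ Γ' ∧ IsGraph Γ' ∧ Finite Γ' ∧ ∃ y, (m, y) ∈ Γ' := by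
  have hc := hH.commutator_sq m
  have hm2 : (m ^ 2) ^ 2 = 1 := by rw [← pow_mul]; exact hH.pow_four m
  -- Put `m ^ 2` and the commutators of `m` with the domain into the domain, so that the relations
  -- to be satisfied by the image of `m` can be stated in `G`.
  obtain ⟨Γ₁, hle, g1, f1, hS, hinv⟩ := hΓ.exists_extend_involutions hH hG
    (S := insert (m ^ 2) ((fun p : H × G => m * p.1 * m⁻¹ * p.1⁻¹) '' Γ))
    ((Set.toFinite _).insert _) (by
      rintro _ (rfl | ⟨p, -, rfl⟩)
      exacts [hm2, hc _])
  by_cases hex : ∃ p ∈ Γ₁, (m * p.1) ^ 2 = 1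
  · obtain ⟨p, hp, hmp⟩ := hex
    obtain ⟨Γ₂, h2, g2, f2, ⟨y, hy⟩, -⟩ := g1.exists_extend_involution hH hG hmp
    refine ⟨Γ₂, hle.trans h2, g2, f2, y * p.2⁻¹, ?_⟩
    convert mul_mem hy (inv_mem (h2 hp)) using 1
    ext <;> simp
  push Not at hex
  obtain ⟨w, hw⟩ := hS _ (Or.inl rfl)
  -- The enlarged domain needs no further commutators: its elements differ from old ones by central
  -- involutions.
  have hcomm : ∀ p ∈ Γ₁, ∃ r ∈ Γ₁, r.1 = m * p.1 * m⁻¹ * p.1⁻¹ := by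
    intro p hp
    obtain ⟨q, hq, hpq⟩ := hinv p hp
    obtain ⟨y, hy⟩ := hS _ (Or.inr ⟨q, hq, rfl⟩)
    refine ⟨_, hy, ?_⟩
    have e1 : p.1 = (p.1 * q.1⁻¹) * q.1 := by group
    have e2 := hH.commutator_mul m (p.1 * q.1⁻¹) q.1
    rw [← e1] at e2
    rw [e2, ← hH.comm _ hpq m]
    group
  have hsnd : ∀ a : Γ₁.map (MonoidHom.snd H G), ∃ p ∈ Γ₁, p.2 = a := fun a => a.2
  choose P hP hPa using hsnd
  choose R hR hRm using fun a => hcomm (P a) (hP a)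
  have hRmul : ∀ a b, R (a * b) = R a * R b := fun a b => by
    refine g1.eq_of_fst (hR _) (mul_mem (hR a) (hR b)) ?_
    have : P (a * b) = P a * P b := g1.eq_of_snd (hP _) (mul_mem (hP a) (hP b)) (by simp [hPa])
    rw [Prod.fst_mul, hRm, hRm, hRm, this, Prod.fst_mul, hH.commutator_mul]
  have hRone : ∀ a, P a ^ 2 = 1 → R a = 1 := fun a ha => by
    refine g1.eq_of_fst (hR a) (one_mem _) ?_
    rw [hRm, ← hH.comm _ (congrArg Prod.fst ha)]
    simp
  let f : Γ₁.map (MonoidHom.snd H G) →* G :=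
    MonoidHom.mk' (fun a => (R a).2) fun a b => by rw [hRmul]; rfl
  have hw2 : (m ^ 2, w) ^ 2 = 1 := g1.eq_of_fst (pow_mem hw 2) (one_mem _) hm2
  have : Finite (Γ₁.map (MonoidHom.snd H G)) :=
    ((Set.toFinite (Γ₁ : Set (H × G))).image Prod.snd).to_subtype
  obtain ⟨y, hyw, hy⟩ := hG.exists_extension (Γ₁.map (MonoidHom.snd H G)) w f
    (congrArg Prod.snd hw2)
    (fun a => by
      have : R a ^ 2 = 1 := g1.eq_of_fst (pow_mem (hR a) 2) (one_mem _) (by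
        rw [Prod.pow_fst, hRm]; exact hc _)
      exact congrArg Prod.snd this)
    (fun a ha => by
      refine congrArg Prod.snd (hRone a (g1.eq_of_snd (pow_mem (hP a) 2) (one_mem _) ?_))
      rw [Prod.pow_snd, hPa]
      exact congrArg Subtype.val ha)
    (fun a ha => by
      have h1 : (m ^ 2, w) * R a * P a ^ 2 ∈ Γ₁ := mul_mem (mul_mem hw (hR a)) (pow_mem (hP a) 2)
      refine hex _ (hP a) ?_
      rw [hH.mul_sq, ← hRm]
      refine (g1 _ h1).2 ?_
      rw [← hPa] at ha
      exact ha)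
  -- If `y` were the image of `p.1`, then `p.1` would commute with `m` and have the same square, so
  -- `(m * p.1) ^ 2 = m ^ 4 = 1`, which `hex` excludes.
  have hynot : ∀ p ∈ Γ₁, p.2 ≠ y := by
    rintro p hp rfl
    have hmem : p.2 ∈ Γ₁.map (MonoidHom.snd H G) := ⟨p, hp, rfl⟩
    have h1 := hy ⟨p.2, hmem⟩
    have hPp : P ⟨p.2, hmem⟩ = p := g1.eq_of_snd (hP _) hp (hPa _)
    have h2 : (R ⟨p.2, hmem⟩).2 = 1 := by
      have h3 : (R ⟨p.2, hmem⟩).2 * p.2 * p.2 = 1 * p.2 * p.2 := by rw [one_mul]; exact h1.symm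
      exact mul_right_cancel (mul_right_cancel h3)
    have h3 := (g1 _ (hR _)).2 h2
    refine hex p hp ?_
    rw [hH.mul_sq, ← hPp, ← hRm, h3, hPp]
    have h4 : (m ^ 2, w) = p ^ 2 := g1.eq_of_snd hw (pow_mem hp 2) (by simp [hyw])
    have h5 : m ^ 2 = p.1 ^ 2 := congrArg Prod.fst h4
    rw [← h5, mul_one, ← sq, hm2]
  obtain ⟨Γ₂, h2, g2, f2, hmem, -⟩ := g1.exists_adjoin (m := m) (y := y)
    (by convert hw using 1; rw [← sq, Prod.pow_mk, hyw])
    (fun p hp => by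
      have hmem : p.2 ∈ Γ₁.map (MonoidHom.snd H G) := ⟨p, hp, rfl⟩
      have hPp : P ⟨p.2, hmem⟩ = p := g1.eq_of_snd (hP _) hp (hPa _)
      convert mul_mem (hR ⟨p.2, hmem⟩) hp using 1
      ext
      · simp [hRm, hPp]
      · simp only [Prod.snd_mul, Prod.snd_inv]
        rw [hy ⟨p.2, hmem⟩, mul_inv_cancel_right]
        rfl)
    (fun p hp e => hex p⁻¹ (inv_mem hp) (by simp [e])) hynot
  exact ⟨Γ₂, hle.trans h2, g2, f2, y, hmem⟩

end Rich

/-! ### Countable rich groups are Fraïssé limits of the class. -/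

section FraisseLimit

theorem IsRich.isUltrahomogeneous {G : Type*} [Group G] [Countable G] (hG : IsRich G) :
    groupLang.IsUltrahomogeneous G := by
  refine (isUltrahomogeneous_iff_IsExtensionPair Structure.cg_of_countable).2
    (isExtensionPair_of_sameTerms fun n u v h m => ?_)
  have := hG.toCentralInvolutions.finite_graph hG.toCentralInvolutions
    (finite_range fun a => (u a, v a))
  obtain ⟨Γ, hle, hgr, -, y, hy⟩ :=
    h.isGraph.exists_extend hG.toCentralInvolutions hG m
  refine ⟨y, hgr.sameTerms ?_⟩
  rintro (a | -)
  · exact hle (Subgroup.subset_closure (mem_range_self a))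
  · exact hy

theorem IsRich.exists_injective {G H : Type*} [Group G] [Group H] [Finite H] (hG : IsRich G)
    (hH : CentralInvolutions H) : ∃ f : H →* G, Function.Injective f := by
  have key : ∀ S : Set H, S.Finite → ∃ Γ : Subgroup (H × G), IsGraph Γ ∧ Finite Γ ∧
      ∀ m ∈ S, ∃ y, (m, y) ∈ Γ := by
    intro S hS
    induction S, hS using Set.Finite.induction_on with
    | empty =>
      exact ⟨⊥, fun p hp => by rw [Subgroup.mem_bot.1 hp]; simp, inferInstance, by simp⟩
    | @insert a S _ _ ih =>
      obtain ⟨Γ, hgr, hfin, hm⟩ := ih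
      obtain ⟨Γ', hle, hgr', hfin', hy⟩ := hgr.exists_extend hH hG a
      refine ⟨Γ', hgr', hfin', ?_⟩
      rintro m (rfl | hmS)
      · exact hy
      · obtain ⟨y, h⟩ := hm m hmS
        exact ⟨y, hle h⟩
  obtain ⟨Γ, hgr, -, hΓ⟩ := key univ finite_univ
  choose f hf using fun m : H => hΓ m (mem_univ m)
  refine ⟨MonoidHom.mk' f fun a b => congrArg Prod.snd
    (hgr.eq_of_fst (hf (a * b)) (mul_mem (hf a) (hf b)) rfl), fun a b hab => ?_⟩
  exact (hgr.fst_eq_iff (hf a) (hf b)).2 hab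

theorem centralInvolutions_iff {H : Type*} [Group H] : CentralInvolutions H ↔
    Monoid.exponent H ∣ 4 ∧ ∀ x : H, orderOf x = 2 → x ∈ Subgroup.center H := by
  rw [Monoid.exponent_dvd_iff_forall_pow_eq_one]
  constructor
  · intro h
    refine ⟨h.pow_four, fun x hx => Subgroup.mem_center_iff.2 fun y => ?_⟩
    exact (h.comm x (hx ▸ pow_orderOf_eq_one x) y).symm
  · rintro ⟨h1, h2⟩
    refine ⟨h1, fun x hx y => ?_⟩
    by_cases hx1 : x = 1
    · simp [hx1]
    · exact (Subgroup.mem_center_iff.1 (h2 x (orderOf_eq_prime hx hx1)) y).symm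

theorem finite_of_fg {G : Type*} [Group G] (hG : CentralInvolutions G)
    {S : groupLang.Substructure G} (hS : S.FG) : (S : Set G).Finite := by
  obtain ⟨n, u, rfl⟩ := Substructure.fg_iff_exists_fin_generating_family.1 hS
  refine ((hG.finitelyManyTerms (Fin n)).image fun F => F u).subset fun x hx => ?_
  obtain ⟨t, ht⟩ := mem_closure_range_iff.1 hx
  exact ⟨_, ⟨t, rfl⟩, ht⟩

/-- A substructure of a group in the language of groups is a subgroup. -/
def toSubgroup {G : Type*} [Group G] (S : groupLang.Substructure G) : Subgroup G where
  carrier := S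
  one_mem' := S.fun_mem (GroupFunc.one : groupLang.Functions 0) Fin.elim0 fun i => i.elim0
  inv_mem' {x} hx := S.fun_mem (GroupFunc.inv : groupLang.Functions 1) ![x] fun i => by
    fin_cases i; exact hx
  mul_mem' {x y} hx hy := S.fun_mem (GroupFunc.mul : groupLang.Functions 2) ![x, y] fun i => by
    fin_cases i; exacts [hx, hy]

theorem nonempty_equiv_toSubgroup_range {G : Type*} [Group G] {N : Type*} [groupLang.Structure N]
    (f : N ↪[groupLang] G) : Nonempty (N ≃[groupLang] toSubgroup f.toHom.range) := by
  refine ⟨⟨Equiv.ofBijective (fun x => ⟨f x, f.toHom.mem_range_self x⟩) ⟨fun x y h => ?_, ?_⟩,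
    fun {n} g xs => ?_, fun {n} r => isEmptyElim r⟩⟩
  · exact f.injective (congrArg Subtype.val h)
  · rintro ⟨_, x, rfl⟩
    exact ⟨x, rfl⟩
  · refine Subtype.ext ((f.map_fun g xs).trans ?_)
    change GroupFunc n at g
    cases g <;> rfl

theorem IsRich.isFraisseLimit (G : Type u) [Group G] [Countable G] (hG : IsRich G) :
    IsFraisseLimit (L := groupLang) centralInvolutionClass.{u} G := by
  refine ⟨hG.isUltrahomogeneous, Set.ext fun N => ⟨?_, ?_⟩⟩
  · rintro ⟨hfg, ⟨f⟩⟩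
    have hfin : Finite (toSubgroup f.toHom.range) :=
      (finite_of_fg hG.toCentralInvolutions (hfg.range f.toHom)).to_subtype
    obtain ⟨h1, h2⟩ := centralInvolutions_iff.1
      (hG.toCentralInvolutions.of_injective (toSubgroup f.toHom.range).subtype
        Subtype.val_injective)
    exact ⟨toSubgroup f.toHom.range, inferInstance, hfin, h1, h2,
      nonempty_equiv_toSubgroup_range f⟩
  · rintro ⟨H, _, hfin, h1, h2, ⟨e⟩⟩
    obtain ⟨f, hf⟩ := hG.exists_injective (centralInvolutions_iff.2 ⟨h1, h2⟩)
    refine ⟨e.fg_iff.2 Structure.FG.of_finite, ⟨Embedding.comp ?_ e.toEmbedding⟩⟩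
    exact Embedding.ofInjective (f := structureHom f) hf

end FraisseLimit

/-! ### Row-by-row construction of a generic anisotropic bilinear map. -/

section BilinearMap

/-- The vector space of countable dimension over the field with two elements. -/
abbrev Vec : Type := ℕ →₀ ZMod 2

/-- Bilinear maps on `Vec` with values in `Vec`. -/
abbrev BilinearMap : Type := Vec →ₗ[ZMod 2] Vec →ₗ[ZMod 2] Vec

/-- The vectors whose coordinates vanish from `n` on. -/
def low (n : ℕ) : Submodule (ZMod 2) Vec where
  carrier := {v | ∀ j, n ≤ j → v j = 0}
  zero_mem' _ _ := rfl
  add_mem' {v w} hv hw j hj := by rw [Finsupp.add_apply, hv j hj, hw j hj, add_zero]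
  smul_mem' c v hv j hj := by rw [Finsupp.smul_apply, hv j hj, smul_zero]

theorem low_mono {m n : ℕ} (h : m ≤ n) : low m ≤ low n := fun _ hv j hj => hv j (h.trans hj)

theorem single_mem_low {i n : ℕ} (h : i < n) (c : ZMod 2) : Finsupp.single i c ∈ low n :=
  fun j hj => Finsupp.single_eq_of_ne (by lia)

theorem exists_mem_low (v : Vec) : ∃ n, v ∈ low n := by
  obtain ⟨n, hn⟩ := v.support.bddAbove
  refine ⟨n + 1, fun j hj => ?_⟩
  by_contra h
  have := hn (Finsupp.mem_support_iff.2 h)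
  lia

theorem linearCombination_mem {M : Type*} [AddCommGroup M] [Module (ZMod 2) M]
    {S : Submodule (ZMod 2) M} {f : ℕ → M} {v : Vec} (h : ∀ j, v j ≠ 0 → f j ∈ S) :
    Finsupp.linearCombination (ZMod 2) f v ∈ S := by
  rw [Finsupp.linearCombination_apply]
  exact Submodule.sum_mem _ fun j hj => S.smul_mem _ (h j (Finsupp.mem_support_iff.1 hj))

theorem linearCombination_congr_of_ne {M : Type*} [AddCommGroup M] [Module (ZMod 2) M]
    {f g : ℕ → M} {v : Vec} (h : ∀ j, v j ≠ 0 → f j = g j) :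
    Finsupp.linearCombination (ZMod 2) f v = Finsupp.linearCombination (ZMod 2) g v := by
  rw [Finsupp.linearCombination_apply, Finsupp.linearCombination_apply]
  exact Finset.sum_congr rfl fun j hj =>
    congrArg (v j • ·) (h j (Finsupp.mem_support_iff.1 hj))

/-- The bilinear map with a given matrix of values on basis vectors. -/
noncomputable def rowsForm (r : ℕ → ℕ → Vec) : BilinearMap :=
  Finsupp.linearCombination (ZMod 2) fun i => Finsupp.linearCombination (ZMod 2) (r i)

theorem rowsForm_single (r : ℕ → ℕ → Vec) (i : ℕ) (v : Vec) :
    rowsForm r (Finsupp.single i 1) v = Finsupp.linearCombination (ZMod 2) (r i) v := by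
  rw [rowsForm, Finsupp.linearCombination_single, one_smul]

theorem rowsForm_congr {r s : ℕ → ℕ → Vec} {n : ℕ} (h : ∀ i < n, r i = s i) {v : Vec}
    (hv : v ∈ low n) : rowsForm r v = rowsForm s v := by
  rw [rowsForm, rowsForm]
  refine linearCombination_congr_of_ne (M := Vec →ₗ[ZMod 2] Vec) fun j hj => ?_
  rw [h j (not_le.1 fun hn => hj (hv j hn))]

/-- A task asks for a vector `e` with prescribed values `B e e` and
`B e v + B v e` for `v ∈ low k`. -/
abbrev Task : Type := ℕ × Vec × (ℕ →₀ Vec)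

/-- A task can be solved by the `n`th basis vector. -/
structure Admissible (n : ℕ) (B : BilinearMap) (t : Task) : Prop where
  le : t.1 ≤ n
  value_mem : t.2.1 ∈ low (n ^ 2 + 1)
  values_mem : ∀ j, t.2.2 j ∈ low (n ^ 2 + 1)
  -- The left side is the value that `B (e + v) (e + v)` will take for the new vector `e`.
  ne : ∀ v ∈ low t.1, t.2.1 + Finsupp.linearCombination (ZMod 2) t.2.2 v + B v v ≠ 0

theorem Admissible.congr {n : ℕ} {B C : BilinearMap} {t : Task}
    (h : ∀ v ∈ low n, B v = C v) (ht : Admissible n B t) : Admissible n C t :=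
  ⟨ht.le, ht.value_mem, ht.values_mem, fun v hv => h v (low_mono ht.le hv) ▸ ht.ne v hv⟩

theorem admissible_default (n : ℕ) (B : BilinearMap) :
    Admissible n B (0, Finsupp.single (n ^ 2) 1, 0) := by
  refine ⟨Nat.zero_le n, single_mem_low (Nat.lt_succ_self _) _, fun j => Submodule.zero_mem _,
    fun v hv => ?_⟩
  have : v = 0 := Finsupp.ext fun j => hv j (Nat.zero_le j)
  simp [this]

/-- The row of values for the `n`th basis vector solving a task. -/
noncomputable def newRow (n : ℕ) (t : Task) (j : ℕ) : Vec :=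
  -- Earlier rows have values in `low (n ^ 2)`, and coordinate `n ^ 2` is reserved for the default
  -- task. Columns from `t.1` up to `n` get private coordinates from `n ^ 2 + 1` on. Zeros to the
  -- right of the diagonal give `B v e = 0` for `v ∈ low n`.
  if j < t.1 then t.2.2 j else if j < n then Finsupp.single (n ^ 2 + 1 + j) 1
    else if j = n then t.2.1 else 0

open Classical in
/-- The given task if it is admissible, and a default one otherwise. -/
noncomputable def chooseTask (n : ℕ) (B : BilinearMap) (t : Task) : Task :=
  if Admissible n B t then t else (0, Finsupp.single (n ^ 2) 1, 0)

theorem admissible_chooseTask (n : ℕ) (B : BilinearMap) (t : Task) :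
    Admissible n B (chooseTask n B t) := by
  rw [chooseTask]
  split_ifs with h
  exacts [h, admissible_default n B]

/-- The rows of a bilinear map solving the tasks in an enumeration. -/
noncomputable def row (T : ℕ → Task) (n : ℕ) : ℕ → Vec :=
  newRow n (chooseTask n (rowsForm fun i => if _h : i < n then row T i else 0) (T n))
termination_by n

/-- Stage `n` sees only the form truncated to earlier rows. Admissibility depends only on its values
on `low n`, where it agrees with the final form. -/
theorem exists_row (T : ℕ → Task) : ∃ r : ℕ → ℕ → Vec, ∀ n, ∃ t, Admissible n (rowsForm r) t ∧
    r n = newRow n t ∧ (Admissible n (rowsForm r) (T n) → t = T n) := by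
  refine ⟨row T, fun n => ?_⟩
  have h : ∀ v ∈ low n, rowsForm (fun i => if _h : i < n then row T i else 0) v =
      rowsForm (row T) v := fun v hv => rowsForm_congr (fun i hi => by simp [hi]) hv
  refine ⟨_, (admissible_chooseTask n _ (T n)).congr h, by rw [row], fun ha => ?_⟩
  rw [chooseTask, if_pos (ha.congr fun v hv => (h v hv).symm)]

section Anisotropic

variable {r : ℕ → ℕ → Vec} {t : ℕ → Task}

theorem newRow_mem_low {n : ℕ} {B : BilinearMap} {t : Task} (ht : Admissible n B t) (j : ℕ) :
    newRow n t j ∈ low ((n + 1) ^ 2) := by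
  have h0 : (n + 1) ^ 2 = n ^ 2 + 2 * n + 1 := by ring
  have h1 : low (n ^ 2 + 1) ≤ low ((n + 1) ^ 2) := low_mono (by lia)
  rw [newRow]
  split_ifs with h2 h3
  · exact h1 (ht.values_mem j)
  · exact single_mem_low (by lia) _
  · exact h1 ht.value_mem
  · exact Submodule.zero_mem _

theorem newRow_eq_zero {n : ℕ} {B : BilinearMap} {t : Task} (ht : Admissible n B t) {j : ℕ}
    (h : n < j) : newRow n t j = 0 := by
  have := ht.le
  rw [newRow, if_neg (by lia), if_neg (by lia), if_neg (by lia)]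

theorem newRow_self {n : ℕ} {B : BilinearMap} {t : Task} (ht : Admissible n B t) :
    newRow n t n = t.2.1 := by
  have := ht.le
  rw [newRow, if_neg (by lia), if_neg (by lia), if_pos rfl]

variable (ht : ∀ n, Admissible n (rowsForm r) (t n)) (hr : ∀ n, r n = newRow n (t n))
include ht hr

theorem rowsForm_mem_low {n : ℕ} {v : Vec} (hv : v ∈ low n) (w : Vec) :
    rowsForm r v w ∈ low (n ^ 2) := by
  rw [rowsForm, Finsupp.linearCombination_apply, Finsupp.sum, LinearMap.sum_apply]
  refine Submodule.sum_mem _ fun i hi => Submodule.smul_mem _ _ (linearCombination_mem fun j _ => ?_)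
  have : i < n := not_le.1 fun hn => Finsupp.mem_support_iff.1 hi (hv i hn)
  rw [hr]
  exact low_mono (Nat.pow_le_pow_left this 2) (newRow_mem_low (ht i) j)

theorem rowsForm_apply_single {n : ℕ} {v : Vec} (hv : v ∈ low n) :
    rowsForm r v (Finsupp.single n 1) = 0 := by
  rw [rowsForm, Finsupp.linearCombination_apply, Finsupp.sum, LinearMap.sum_apply]
  refine Finset.sum_eq_zero fun i hi => ?_
  have : i < n := not_le.1 fun hn => Finsupp.mem_support_iff.1 hi (hv i hn)
  rw [LinearMap.smul_apply, Finsupp.linearCombination_single, hr, newRow_eq_zero (ht i) this,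
    smul_zero, smul_zero]

omit ht in
theorem rowsForm_single_low {n : ℕ} {v : Vec} (hv : v ∈ low (t n).1) :
    rowsForm r (Finsupp.single n 1) v = Finsupp.linearCombination (ZMod 2) (t n).2.2 v := by
  rw [rowsForm_single]
  refine linearCombination_congr_of_ne fun j hj => ?_
  rw [hr, newRow, if_pos (not_le.1 fun hn => hj (hv j hn))]

theorem rowsForm_single_self (n : ℕ) :
    rowsForm r (Finsupp.single n 1) (Finsupp.single n 1) = (t n).2.1 := by
  rw [rowsForm_single, Finsupp.linearCombination_single, one_smul, hr, newRow_self (ht n)]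

/-- Among the columns below `n`, coordinate `n ^ 2 + 1 + j` of row `n` is nonzero only in column
`j`: prescribed values lie in `low (n ^ 2 + 1)`, and other fresh vectors use other coordinates. -/
theorem rowsForm_single_apply_fresh {n j : ℕ} (hj : (t n).1 ≤ j) (hjn : j < n) {v : Vec}
    (hv : v ∈ low n) : rowsForm r (Finsupp.single n 1) v (n ^ 2 + 1 + j) = v j := by
  have hv' : v.erase j ∈ low n := fun i hi => by
    rw [Finsupp.erase_apply]; split_ifs; exacts [rfl, hv i hi]
  have h0 : ∀ w ∈ low n, w j = 0 → rowsForm r (Finsupp.single n 1) w (n ^ 2 + 1 + j) = 0 := by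
    intro w hw hwj
    rw [rowsForm_single]
    have : Finsupp.linearCombination (ZMod 2) (r n) w ∈
        LinearMap.ker (Finsupp.lapply (n ^ 2 + 1 + j) : Vec →ₗ[ZMod 2] ZMod 2) := by
      refine linearCombination_mem fun i hi => ?_
      have hin : i < n := not_le.1 fun hn => hi (hw i hn)
      have hij : i ≠ j := by rintro rfl; exact hi hwj
      rw [LinearMap.mem_ker, Finsupp.lapply_apply, hr, newRow]
      split_ifs with h1
      · exact (ht n).values_mem i _ (by lia)
      · exact Finsupp.single_eq_of_ne (by lia)
    exact this
  have hdec : v = v.erase j + v j • Finsupp.single j 1 := by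
    rw [Finsupp.smul_single, smul_eq_mul, mul_one, Finsupp.erase_add_single]
  conv_lhs => rw [hdec]
  rw [LinearMap.map_add, LinearMap.map_smul, Finsupp.add_apply, h0 _ hv' (by simp), Finsupp.smul_apply, rowsForm_single,
    Finsupp.linearCombination_single, one_smul, hr, newRow, if_neg (not_lt.2 hj), if_pos hjn]
  simp

/-- Write `v = x + e` with `e` the top basis vector. If `x` lies in the task's domain, admissibility
applies; otherwise a private coordinate of the new row survives, beyond the reach of `B x x` and `B
e e`. -/
theorem rowsForm_self_ne_zero {v : Vec} (hv : v ≠ 0) : rowsForm r v v ≠ 0 := by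
  suffices ∀ n, ∀ v ∈ low n, v ≠ 0 → rowsForm r v v ≠ 0 by
    obtain ⟨n, hn⟩ := exists_mem_low v
    exact this n v hn hv
  clear hv v
  intro n
  induction n with
  | zero => exact fun v hv h => absurd (Finsupp.ext fun j => hv j (Nat.zero_le j)) h
  | succ n ih =>
    intro v hv hv0
    by_cases hvn : v n = 0
    · refine ih v (fun j hj => ?_) hv0
      rcases hj.eq_or_lt with rfl | h
      exacts [hvn, hv j h]
    have hv1 : v n = 1 := by
      have : ∀ c : ZMod 2, c ≠ 0 → c = 1 := by decide
      exact this _ hvn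
    set x := v.erase n with hx
    have hxl : x ∈ low n := fun j hj => by
      rw [hx, Finsupp.erase_apply]
      split_ifs with h
      exacts [rfl, hv j (by lia)]
    have hdec : v = x + Finsupp.single n 1 := by
      rw [hx, ← hv1, Finsupp.erase_add_single]
    have hval : rowsForm r v v = rowsForm r x x + (rowsForm r (Finsupp.single n 1) x + (t n).2.1) := by
      rw [hdec, LinearMap.map_add, LinearMap.map_add, LinearMap.add_apply, LinearMap.add_apply,
        rowsForm_apply_single ht hr hxl, rowsForm_single_self ht hr, zero_add, add_assoc]
    rw [hval]
    by_cases hk : x ∈ low (t n).1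
    · rw [rowsForm_single_low hr hk]
      have := (ht n).ne x hk
      convert this using 1
      abel
    · have : ∃ j, (t n).1 ≤ j ∧ x j ≠ 0 := by
        by_contra hcon
        push Not at hcon
        exact hk hcon
      obtain ⟨j, hj, hxj⟩ := this
      have hjn : j < n := not_le.1 fun h => hxj (hxl j h)
      intro h0
      have h1 := DFunLike.congr_fun h0 (n ^ 2 + 1 + j)
      rw [Finsupp.add_apply, Finsupp.add_apply, rowsForm_single_apply_fresh ht hr hj hjn hxl,
        rowsForm_mem_low ht hr hxl x _ (by lia), (ht n).value_mem _ (by lia), zero_add, add_zero] at h1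
      exact hxj h1

end Anisotropic

/-- Tasks must recur arbitrarily late, since one becomes admissible only after `n` has passed its
domain and the supports of its data. -/
theorem exists_recurrent_enumeration (α : Type) [Countable α] [Nonempty α] :
    ∃ T : ℕ → α, ∀ a N, ∃ n, N ≤ n ∧ T n = a := by
  obtain ⟨f, hf⟩ := exists_surjective_nat α
  refine ⟨fun n => f n.unpair.1, fun a N => ?_⟩
  obtain ⟨m, rfl⟩ := hf a
  exact ⟨Nat.pair m N, Nat.right_le_pair m N, by simp⟩

/-- There is a bilinear map without isotropic vectors for which all consistent tasks are solved. -/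
theorem exists_generic_bilinearMap : ∃ B : BilinearMap, (∀ v, v ≠ 0 → B v v ≠ 0) ∧
    ∀ (k : ℕ) (w : Vec) (g : Vec →ₗ[ZMod 2] Vec), (∀ v ∈ low k, w + g v + B v v ≠ 0) →
      ∃ e : Vec, B e e = w ∧ ∀ v ∈ low k, B e v + B v e = g v := by
  obtain ⟨T, hT⟩ := exists_recurrent_enumeration Task
  obtain ⟨r, hrow⟩ := exists_row T
  choose t ht hr htT using hrow
  refine ⟨rowsForm r, fun v hv => rowsForm_self_ne_zero ht hr hv, fun k w g hcons => ?_⟩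
  classical
  -- Only finitely many values of `g` matter; a finitely supported record keeps the set of tasks
  -- countable.
  let g' : ℕ →₀ Vec := Finsupp.onFinset (Finset.range k)
    (fun j => if j < k then g (Finsupp.single j 1) else 0) (fun j hj => by
      by_contra h
      exact hj (if_neg (by simpa using h)))
  have hg' : ∀ v ∈ low k, Finsupp.linearCombination (ZMod 2) g' v = g v := by
    intro v hv
    have h1 : Finsupp.linearCombination (ZMod 2) g' v =
        Finsupp.linearCombination (ZMod 2) (fun j => g (Finsupp.single j 1)) v :=
      linearCombination_congr_of_ne fun j hj => if_pos (not_le.1 fun hn => hj (hv j hn))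
    rw [h1, Finsupp.linearCombination_apply]
    conv_rhs => rw [← Finsupp.sum_single v]
    rw [Finsupp.sum, Finsupp.sum, map_sum]
    refine Finset.sum_congr rfl fun j _ => ?_
    rw [← map_smul, Finsupp.smul_single, smul_eq_mul, mul_one]
  obtain ⟨N₀, hN₀⟩ := exists_mem_low w
  choose N hN using fun j => exists_mem_low (g' j)
  obtain ⟨n, hn, hTn⟩ := hT (k, w, g') (k + N₀ + ∑ j ∈ Finset.range k, N j)
  have hnn : n ≤ n ^ 2 + 1 := by nlinarith
  have hadm : Admissible n (rowsForm r) (T n) := by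
    rw [hTn]
    refine ⟨by simp only; lia, low_mono (by lia) hN₀, fun j => ?_, fun v hv => ?_⟩
    · by_cases hj : j < k
      · have := Finset.single_le_sum (f := N) (fun _ _ => Nat.zero_le _) (Finset.mem_range.2 hj)
        exact low_mono (by lia) (hN j)
      · have : g' j = 0 := if_neg hj
        simp only [this]
        exact Submodule.zero_mem _
    · simp only
      rw [hg' v hv]
      exact hcons v hv
  have htn := (htT n hadm).trans hTn
  have hkn : k ≤ n := by lia
  refine ⟨Finsupp.single n 1, ?_, fun v hv => ?_⟩
  · rw [rowsForm_single_self ht hr, htn]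
  · rw [rowsForm_apply_single ht hr (low_mono hkn hv), add_zero,
      rowsForm_single_low hr (by rw [htn]; exact hv), htn]
    exact hg' v hv

end BilinearMap

/-! ### Generic bilinear maps and the associated central extension. -/

section Generic

/-- A bilinear map without isotropic vectors, for which all consistent requirements on the values
at a new vector can be met. -/
structure IsGeneric (B : BilinearMap) : Prop where
  anisotropic : ∀ v, B v v = 0 → v = 0
  solve : ∀ (k : ℕ) (w : Vec) (g : Vec →ₗ[ZMod 2] Vec),
    (∀ v ∈ low k, w + g v + B v v ≠ 0) →
      ∃ e : Vec, B e e = w ∧ ∀ v ∈ low k, B e v + B v e = g v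

theorem exists_isGeneric : ∃ B, IsGeneric B := by
  obtain ⟨B, h1, h2⟩ := exists_generic_bilinearMap
  exact ⟨B, fun v hv => by_contra fun h => h1 v h hv, h2⟩

theorem finite_low (n : ℕ) : (low n : Set Vec).Finite := by
  refine Set.Finite.of_injOn (f := fun v (i : Fin n) => v i) (t := univ) (fun _ _ => mem_univ _)
    (fun v hv w hw h => ?_) finite_univ
  ext i
  by_cases hi : i < n
  · exact congrFun h ⟨i, hi⟩
  · rw [hv i (not_lt.1 hi), hw i (not_lt.1 hi)]

theorem exists_low_of_finite {S : Set Vec} (hS : S.Finite) : ∃ n, S ⊆ low n := by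
  induction S, hS using Set.Finite.induction_on with
  | empty => exact ⟨0, empty_subset _⟩
  | @insert a S _ _ ih =>
    obtain ⟨n, hn⟩ := ih
    obtain ⟨m, hm⟩ := exists_mem_low a
    exact ⟨max m n, insert_subset (low_mono (le_max_left _ _) hm)
      (hn.trans (low_mono (le_max_right _ _)))⟩

/-- Shifting the coordinates of a vector. -/
noncomputable def shift (n : ℕ) : Vec →ₗ[ZMod 2] Vec :=
  Finsupp.lmapDomain (ZMod 2) (ZMod 2) (· + n)

theorem shift_apply_add (n : ℕ) (v : Vec) (i : ℕ) : shift n v (i + n) = v i :=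
  Finsupp.mapDomain_apply (add_left_injective n) v i

theorem shift_apply_of_lt {n i : ℕ} (h : i < n) (v : Vec) : shift n v i = 0 :=
  Finsupp.mapDomain_of_notMem_range v i (by rintro ⟨j, rfl⟩; simp at h)

theorem shift_injective (n : ℕ) : Function.Injective (shift n) :=
  Finsupp.mapDomain_injective (add_left_injective n)

theorem eq_zero_of_shift_mem_low {n : ℕ} {v : Vec} (h : shift n v ∈ low n) : v = 0 :=
  Finsupp.ext fun i => by
    rw [← shift_apply_add n v i]
    exact h _ (Nat.le_add_left n i)

variable {B : BilinearMap}

/-- Extend `g` from `p` to `low k` by sending a complement beyond coordinate `N`, above all the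
other data. A forbidden cancellation then forces `v ∈ p`, where the hypothesis excludes it. -/
theorem IsGeneric.solve_on_submodule (hB : IsGeneric B) {p : Submodule (ZMod 2) Vec}
    (hp : (p : Set Vec).Finite) (w : Vec) (g : p →ₗ[ZMod 2] Vec)
    (h : ∀ v : p, w + g v + B v v ≠ 0) :
    ∃ e : Vec, B e e = w ∧ ∀ v : p, B e v + B v e = g v := by
  obtain ⟨k, hk⟩ := exists_low_of_finite hp
  have := hp.to_subtype
  obtain ⟨N, hN⟩ := exists_low_of_finite ((((finite_low k).image fun v => B v v).union
    (finite_range g)).union (finite_singleton w))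
  obtain ⟨pr, hpr⟩ : ∃ pr : Vec →ₗ[ZMod 2] p, pr ∘ₗ p.subtype = LinearMap.id :=
    LinearMap.exists_leftInverse_of_injective _ p.ker_subtype
  have hpr' : ∀ v : p, pr v = v := fun v => LinearMap.congr_fun hpr v
  obtain ⟨e, he, hev⟩ := hB.solve k w (g ∘ₗ pr + shift N ∘ₗ (LinearMap.id - p.subtype ∘ₗ pr)) (by
    intro v hv h0
    have h1 : shift N (v - pr v) ∈ low N := by
      have e1 : shift N (v - pr v) = -(w + g (pr v) + B v v) := by
        rw [eq_neg_iff_add_eq_zero, ← h0]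
        simp only [LinearMap.add_apply, LinearMap.comp_apply, LinearMap.sub_apply,
          LinearMap.id_apply, Submodule.subtype_apply]
        abel
      rw [e1]
      exact neg_mem (add_mem (add_mem (hN (Or.inr rfl)) (hN (Or.inl (Or.inr ⟨_, rfl⟩))))
        (hN (Or.inl (Or.inl ⟨v, hv, rfl⟩))))
    have h2 : v = pr v := sub_eq_zero.1 (eq_zero_of_shift_mem_low h1)
    refine h (pr v) ?_
    rw [← h0]
    simp only [LinearMap.add_apply, LinearMap.comp_apply, LinearMap.sub_apply,
      LinearMap.id_apply, Submodule.subtype_apply, ← h2, sub_self, map_zero, add_zero])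
  refine ⟨e, he, fun v => ?_⟩
  rw [hev v (hk v.2)]
  simp [hpr']

/-- One `F` serves all `T`, which makes commutators with different `e` comparable. Consistency is
seen in coordinate `N`: it is `1` in the prescribed square and `0` in `B v v` and in the image of
`F`. -/
theorem IsGeneric.exists_injective (hB : IsGeneric B) (n : ℕ) :
    ∃ F : Vec →ₗ[ZMod 2] Vec, Function.Injective F ∧ ∀ T : Vec →ₗ[ZMod 2] Vec,
      ∃ e : Vec, ∀ v ∈ low n, B e v + B v e = F (T v) := by
  obtain ⟨N, hN⟩ := exists_low_of_finite ((finite_low n).image fun v => B v v)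
  refine ⟨shift (N + 1), shift_injective _, fun T => ?_⟩
  obtain ⟨e, -, he⟩ := hB.solve n (Finsupp.single N 1) (shift (N + 1) ∘ₗ T) (by
    intro v hv h
    have h1 := DFunLike.congr_fun h N
    rw [Finsupp.add_apply, Finsupp.add_apply, LinearMap.comp_apply,
      shift_apply_of_lt (Nat.lt_succ_self N), hN ⟨v, hv, rfl⟩ N le_rfl] at h1
    simp at h1)
  exact ⟨e, he⟩

/-- The central extension of `Vec` by `Vec` given by a bilinear map. -/
@[ext]
structure BilinearGroup (B : BilinearMap) : Type u where
  /-- The image in the quotient. -/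
  fst : Vec
  /-- The central component. -/
  snd : Vec

namespace BilinearGroup

noncomputable instance : Mul (BilinearGroup.{u} B) :=
  ⟨fun x y => ⟨x.fst + y.fst, x.snd + y.snd + B x.fst y.fst⟩⟩

instance : One (BilinearGroup.{u} B) := ⟨⟨0, 0⟩⟩

noncomputable instance : Inv (BilinearGroup.{u} B) := ⟨fun x => ⟨-x.fst, -x.snd + B x.fst x.fst⟩⟩

@[simp] theorem fst_mul (x y : BilinearGroup.{u} B) : (x * y).fst = x.fst + y.fst := rfl

@[simp] theorem snd_mul (x y : BilinearGroup.{u} B) :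
    (x * y).snd = x.snd + y.snd + B x.fst y.fst := rfl

@[simp] theorem fst_one : (1 : BilinearGroup.{u} B).fst = 0 := rfl

@[simp] theorem snd_one : (1 : BilinearGroup.{u} B).snd = 0 := rfl

@[simp] theorem fst_inv (x : BilinearGroup.{u} B) : x⁻¹.fst = -x.fst := rfl

@[simp] theorem snd_inv (x : BilinearGroup.{u} B) : x⁻¹.snd = -x.snd + B x.fst x.fst := rfl

noncomputable instance : Group (BilinearGroup.{u} B) :=
  Group.ofLeftAxioms
    (fun x y z => BilinearGroup.ext (add_assoc _ _ _) (by
      simp only [snd_mul, fst_mul, map_add, LinearMap.add_apply]; abel))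
    (fun x => BilinearGroup.ext (zero_add _) (by simp))
    (fun x => BilinearGroup.ext (neg_add_cancel _) (by simp))

instance : Countable (BilinearGroup.{u} B) :=
  Function.Injective.countable (f := fun x : BilinearGroup.{u} B => (x.fst, x.snd))
    fun _ _ h => BilinearGroup.ext (congrArg Prod.fst h) (congrArg Prod.snd h)

theorem vec_add_self (v : Vec) : v + v = 0 := by
  ext i
  exact CharTwo.add_self_eq_zero (v i)

theorem sq_eq (x : BilinearGroup.{u} B) : x ^ 2 = ⟨0, B x.fst x.fst⟩ := by
  rw [sq]
  ext1 <;> simp [vec_add_self]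

theorem mul_eq_iff {x y z : BilinearGroup.{u} B} (hz : z.fst = 0) :
    y * x = z * x * y ↔ B y.fst x.fst + B x.fst y.fst = z.snd := by
  rw [BilinearGroup.ext_iff]
  simp only [fst_mul, snd_mul, hz, zero_add, map_zero, LinearMap.zero_apply, add_zero]
  rw [and_iff_right (add_comm _ _), ← sub_eq_zero, ← sub_eq_zero (b := z.snd)]
  have h : ∀ v : Vec, -v = v := fun v => (eq_neg_of_add_eq_zero_left (vec_add_self v)).symm
  have : y.snd + x.snd + B y.fst x.fst - (z.snd + x.snd + y.snd + B x.fst y.fst) =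
      B y.fst x.fst + -B x.fst y.fst - z.snd := by abel
  rw [this, h]

theorem commutator_eq (y x : BilinearGroup.{u} B) :
    y * x * y⁻¹ * x⁻¹ = ⟨0, B y.fst x.fst + B x.fst y.fst⟩ := by
  rw [mul_inv_eq_iff_eq_mul, mul_inv_eq_iff_eq_mul, mul_eq_iff rfl]

theorem sq_eq_one_iff (hB : IsGeneric B) {x : BilinearGroup.{u} B} : x ^ 2 = 1 ↔ x.fst = 0 := by
  rw [sq_eq, BilinearGroup.ext_iff]
  constructor
  · exact fun h => hB.anisotropic _ h.2
  · intro h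
    simp [h]

theorem centralInvolutions (hB : IsGeneric B) : CentralInvolutions (BilinearGroup.{u} B) where
  pow_four x := by
    rw [show 4 = 2 * 2 from rfl, pow_mul, sq_eq_one_iff hB, sq_eq]
  comm x hx y := by
    rw [sq_eq_one_iff hB] at hx
    ext1 <;> simp [hx, add_comm]

theorem isRich (hB : IsGeneric B) : IsRich (BilinearGroup.{u} B) where
  toCentralInvolutions := centralInvolutions hB
  infinite_involutions := by
    refine Set.infinite_of_injective_forall_mem (f := fun n : ℕ =>
      (⟨0, Finsupp.single n 1⟩ : BilinearGroup.{u} B)) (fun m n h => ?_) fun n => ?_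
    · exact Finsupp.single_left_injective one_ne_zero (congrArg snd h)
    · exact (sq_eq_one_iff hB).2 rfl
  exists_extension A _ w f hw hf hf1 hne := by
    have hf0 : ∀ a, (f a).fst = 0 := fun a => (sq_eq_one_iff hB).1 (hf a)
    have hw0 : w.fst = 0 := (sq_eq_one_iff hB).1 hw
    have hfmul : ∀ a b, (f (a * b)).snd = (f a).snd + (f b).snd := fun a b => by
      rw [map_mul, snd_mul, hf0, map_zero, LinearMap.zero_apply, add_zero]
    -- Elements with equal first component differ by a solution of `x ^ 2 = 1`, on which `f` is
    -- trivial; hence `f` induces a linear map on `p`.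
    have hwd : ∀ a b : A, (a : BilinearGroup.{u} B).fst = (b : BilinearGroup.{u} B).fst →
        f a = f b := fun a b hab => by
      have h1 : f (a * b⁻¹) = 1 := hf1 _ (Subtype.ext ((sq_eq_one_iff hB).2 (by simp [hab])))
      rwa [map_mul, map_inv, mul_inv_eq_one] at h1
    let p : Submodule (ZMod 2) Vec :=
      { carrier := range fun a : A => (a : BilinearGroup.{u} B).fst
        zero_mem' := ⟨1, rfl⟩
        add_mem' := by
          rintro _ _ ⟨a, rfl⟩ ⟨b, rfl⟩
          exact ⟨a * b, rfl⟩
        smul_mem' := by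
          rintro c _ ⟨a, rfl⟩
          have : ∀ c : ZMod 2, c = 0 ∨ c = 1 := by decide
          rcases this c with rfl | rfl
          · exact ⟨1, (zero_smul _ _).symm⟩
          · exact ⟨a, (one_smul _ _).symm⟩ }
    choose s hs' using fun v : p => v.2
    have hs : ∀ v : p, (s v : BilinearGroup.{u} B).fst = v := hs'
    let g₀ : p →+ Vec := AddMonoidHom.mk' (fun v => (f (s v)).snd) fun v v' => by
      rw [← hfmul]
      congr 1
      refine hwd _ _ ?_
      rw [hs, Subgroup.coe_mul, fst_mul, hs, hs, Submodule.coe_add]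
    obtain ⟨e, he, hev⟩ := hB.solve_on_submodule (p := p) (finite_range _) w.snd
      (g₀.toZModLinearMap 2) (fun v h0 => by
        refine hne (s v) (BilinearGroup.ext ?_ ?_)
        · simp [hf0, hw0, sq_eq]
        · have h1 : w.snd + (f (s v)).snd + B v v = 0 := h0
          rw [← hs] at h1
          simpa [hf0, hw0, sq_eq] using h1)
    refine ⟨⟨e, 0⟩, ?_, fun a => ?_⟩
    · rw [sq_eq, he]
      exact BilinearGroup.ext hw0.symm rfl
    · rw [mul_eq_iff (hf0 a)]
      have := hev ⟨_, a, rfl⟩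
      refine this.trans (congrArg snd (hwd _ _ ?_))
      exact hs _

theorem exists_not_commute (hB : IsGeneric B) : ∃ x y : BilinearGroup.{u} B, y * x ≠ x * y := by
  obtain ⟨F, hF, h⟩ := hB.exists_injective 1
  obtain ⟨e, he⟩ := h LinearMap.id
  refine ⟨⟨Finsupp.single 0 1, 0⟩, ⟨e, 0⟩, fun hc => ?_⟩
  have h1 := (mul_eq_iff (B := B) (x := ⟨Finsupp.single 0 1, 0⟩) (y := ⟨e, 0⟩) (z := 1) rfl).1
    (by rwa [one_mul])
  rw [he _ (single_mem_low one_pos 1)] at h1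
  have h2 : Finsupp.single 0 1 = (0 : Vec) := hF (h1.trans (map_zero F).symm)
  exact one_ne_zero (Finsupp.single_eq_zero.1 h2)

end BilinearGroup

end Generic

/-! ### Nilpotency class and the failure of geometric finiteness. -/

section Main

theorem GeometricallyFinite.of_equiv {L : FirstOrder.Language.{0, 0}} {M N : Type u}
    [L.Structure M] [L.Structure N] (f : M ≃[L] N) (h : GeometricallyFinite L M) :
    GeometricallyFinite L N := by
  obtain ⟨lt, ⟨e⟩, h⟩ := h
  refine ⟨fun x y => lt (f.symm x) (f.symm y), ⟨RelIso.trans ⟨f.symm.toEquiv, Iff.rfl⟩ e⟩,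
    fun n a => ?_⟩
  obtain ⟨i, j, hij, α, hα, hαa⟩ := h n fun i k => f.symm (a i k)
  refine ⟨i, j, hij, f.toElementaryEmbedding.comp (α.comp f.symm.toElementaryEmbedding),
    fun x y hxy => ?_, fun k => ?_⟩
  · change lt (f.symm (f (α (f.symm x)))) (f.symm (f (α (f.symm y))))
    rw [f.symm_apply_apply, f.symm_apply_apply]
    exact hα _ _ hxy
  · change f (α (f.symm (a i k))) = a j k
    rw [hαa, f.apply_symm_apply]

theorem CentralInvolutions.nilpotencyClass_eq_two {G : Type*} [Group G]
    (hG : CentralInvolutions G) {x y : G} (hxy : y * x ≠ x * y) :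
    Group.IsNilpotent G ∧ Group.nilpotencyClass G = 2 := by
  have h1 : Subgroup.upperCentralSeries G 2 = ⊤ := by
    refine eq_top_iff.2 fun x _ => ?_
    rw [Subgroup.mem_upperCentralSeries_succ_iff]
    intro y
    rw [Subgroup.upperCentralSeries_one, Subgroup.mem_center_iff]
    exact fun z => (hG.comm _ (hG.commutator_sq x y) z).symm
  have hn : Group.IsNilpotent G := ⟨2, h1⟩
  refine ⟨hn, le_antisymm (Subgroup.upperCentralSeries_eq_top_iff_nilpotencyClass_le.1 h1) ?_⟩
  by_contra hlt
  have h2 := Subgroup.upperCentralSeries_eq_top_iff_nilpotencyClass_le.2 (show Group.nilpotencyClass G ≤ 1 by lia)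
  rw [Subgroup.upperCentralSeries_one] at h2
  exact hxy (Subgroup.mem_center_iff.1 (h2 ▸ Subgroup.mem_top x) y)

variable {B : BilinearMap}

/-- The truncated shift of basis vectors, which vanishes on the basis vectors from `k` on. -/
noncomputable def truncatedShift (k : ℕ) : Vec →ₗ[ZMod 2] Vec :=
  Finsupp.linearCombination (ZMod 2) fun s => if s < k then Finsupp.single (s + 1) 1 else 0

theorem truncatedShift_single (k s : ℕ) : truncatedShift k (Finsupp.single s 1) =
    if s < k then Finsupp.single (s + 1) 1 else 0 := by
  rw [truncatedShift, Finsupp.linearCombination_single, one_smul]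

/-- For any finite set there are two elements acting by commutators through an injective linear map
and through its composition with the truncated shift. -/
theorem IsGeneric.exists_coding_pair (hB : IsGeneric B) {S : Set (BilinearGroup.{u} B)}
    (hS : S.Finite) (k : ℕ) : ∃ (F : Vec →ₗ[ZMod 2] Vec) (y y' : BilinearGroup.{u} B),
      Function.Injective F ∧ ∀ x ∈ S, y * x * y⁻¹ * x⁻¹ = ⟨0, F x.fst⟩ ∧
        y' * x * y'⁻¹ * x⁻¹ = ⟨0, F (truncatedShift k x.fst)⟩ := by
  obtain ⟨n, hn⟩ := exists_low_of_finite (hS.image BilinearGroup.fst)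
  obtain ⟨F, hF, h⟩ := hB.exists_injective n
  obtain ⟨e, he⟩ := h LinearMap.id
  obtain ⟨e', he'⟩ := h (truncatedShift k)
  refine ⟨F, ⟨e, 0⟩, ⟨e', 0⟩, hF, fun x hx => ?_⟩
  rw [BilinearGroup.commutator_eq, BilinearGroup.commutator_eq, he _ (hn ⟨x, hx, rfl⟩),
    he' _ (hn ⟨x, hx, rfl⟩)]
  exact ⟨rfl, rfl⟩

theorem IsGeneric.not_geometricallyFinite (hB : IsGeneric B) :
    ¬ GeometricallyFinite groupLang (BilinearGroup.{u} B) := by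
  rintro ⟨lt, ⟨rk⟩, h⟩
  let b : ℕ → BilinearGroup.{u} B := fun s => ⟨Finsupp.single s 1, 0⟩
  -- The sum is just a convenient upper bound for the ranks of `b 0, …, b k`.
  let bound : ℕ → ℕ := fun k => ∑ s ∈ Finset.range (k + 1), rk (b s)
  have hb : ∀ k s, s ≤ k → rk (b s) ≤ bound k := fun k s hs =>
    Finset.single_le_sum (f := fun s => rk (b s)) (fun _ _ => Nat.zero_le _)
      (Finset.mem_range.2 (Nat.lt_succ_of_le hs))
  have hfin : ∀ k, {x | rk x ≤ bound k}.Finite := fun k =>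
    (Set.finite_Iic (bound k)).preimage rk.injective.injOn
  choose F y y' hF hy using fun k => hB.exists_coding_pair (hfin k) k
  -- The tuple records the start of the shift chain, the last element of the segment and the two
  -- coding elements.
  obtain ⟨i, j, hij, α, hlt, hα⟩ := h 4 fun k => ![b 0, rk.symm (bound k), y k, y' k]
  let φ : BilinearGroup.{u} B →* BilinearGroup.{u} B := homOfEmbedding α.toEmbedding
  have hφ : Function.Injective φ := α.injective
  have h0 : φ (b 0) = b 0 := hα 0
  have hm : φ (rk.symm (bound i)) = rk.symm (bound j) := hα 1
  have hφy : φ (y i) = y j := hα 2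
  have hφy' : φ (y' i) = y' j := hα 3
  have hbd : ∀ x, rk x ≤ bound i → rk (φ x) ≤ bound j := by
    intro x hx
    have e1 : bound j = rk (φ (rk.symm (bound i))) := by rw [hm, RelIso.apply_symm_apply]
    rw [e1]
    rcases hx.eq_or_lt with h1 | h1
    · rw [← h1, RelIso.symm_apply_apply]
    · refine le_of_lt (rk.map_rel_iff.2 (hlt _ _ (rk.map_rel_iff.1 ?_)))
      rwa [RelIso.apply_symm_apply]
  have hcomm : ∀ x, rk x ≤ bound i →
      φ ⟨0, F i x.fst⟩ = ⟨0, F j (φ x).fst⟩ ∧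
      φ ⟨0, F i (truncatedShift i x.fst)⟩ = ⟨0, F j (truncatedShift j (φ x).fst)⟩ := by
    intro x hx
    have h1 := hy i x hx
    have h2 := hy j (φ x) (hbd x hx)
    rw [← h1.1, ← h1.2, ← h2.1, ← h2.2]
    simp only [map_mul, map_inv, hφy, hφy', and_self]
  -- The next basis element is the truncated shift of the current one, a relation read off from
  -- commutators; injectivity of `F j` recovers it on the image side.
  have key : ∀ s, s ≤ i → s ≤ j → (φ (b s)).fst = Finsupp.single s 1 := by
    intro s
    induction s with
    | zero => exact fun _ _ => by rw [h0]
    | succ s ih =>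
      intro hsi hsj
      have h1 := (hcomm (b s) (hb i s (by lia))).2
      have h2 := (hcomm (b (s + 1)) (hb i (s + 1) hsi)).1
      rw [ih (by lia) (by lia), truncatedShift_single, truncatedShift_single,
        if_pos (Nat.lt_of_succ_le hsi), if_pos (Nat.lt_of_succ_le hsj)] at h1
      exact (hF j (congrArg BilinearGroup.snd (h1.symm.trans h2))).symm
  -- At the smaller index one truncated shift kills the basis vector. The injective `φ` preserves
  -- triviality, so the other must kill it too, forcing `i = j`.
  have hmin := (hcomm (b (min i j)) (hb i _ (min_le_left _ _))).2
  rw [key _ (min_le_left _ _) (min_le_right _ _), truncatedShift_single,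
    truncatedShift_single] at hmin
  have hz : ∀ k v, (⟨0, F k v⟩ : BilinearGroup.{u} B) = 1 ↔ v = 0 := fun k v => by
    rw [← (F k).map_eq_zero_iff (hF k)]
    exact ⟨congrArg BilinearGroup.snd, fun h => BilinearGroup.ext rfl h⟩
  have hiff : min i j < i ↔ min i j < j := by
    have h1 := hz i (if min i j < i then Finsupp.single (min i j + 1) 1 else 0)
    have h2 := hz j (if min i j < j then Finsupp.single (min i j + 1) 1 else 0)
    rw [← hmin, map_eq_one_iff φ hφ, h1] at h2
    split_ifs at h2 with h3 h4 h4 <;> simp_all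
  exact hij (by lia)

end Main

end NiceEnum

theorem mainTheorem1 :
    (∃ (G : Type u) (_ : Group G) (_ : Countable G),
      FirstOrder.Language.IsFraisseLimit (L := NiceEnum.groupLang)
        NiceEnum.centralInvolutionClass.{u} G) ∧
    ∀ (G : Type u) [Group G] [Countable G],
      FirstOrder.Language.IsFraisseLimit (L := NiceEnum.groupLang)
        NiceEnum.centralInvolutionClass.{u} G →
        NiceEnum.IsOmegaCategorical NiceEnum.groupLang G ∧
        (Group.IsNilpotent G ∧ Group.nilpotencyClass G = 2) ∧
        NiceEnum.HasQuantifierElimination NiceEnum.groupLang G ∧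
        ¬ NiceEnum.GeometricallyFinite NiceEnum.groupLang G := by
  obtain ⟨B, hB⟩ := NiceEnum.exists_isGeneric
  have hrich := NiceEnum.BilinearGroup.isRich.{u} hB
  have hlim := hrich.isFraisseLimit
  refine ⟨⟨_, _, _, hlim⟩, fun G _ _ hG => ?_⟩
  -- By uniqueness of Fraïssé limits, it remains to transfer properties of the concrete model along
  -- `e`.
  obtain ⟨e⟩ := hG.nonempty_equiv hlim
  let f := NiceEnum.mulEquivOfEquiv e
  have hc := hrich.toCentralInvolutions.of_injective f.toMonoidHom f.injective
  have : Infinite (NiceEnum.BilinearGroup.{u} B) :=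
    Set.infinite_univ_iff.1 (hrich.infinite_involutions.mono (Set.subset_univ _))
  have : Infinite G := Infinite.of_injective f.symm f.symm.injective
  obtain ⟨x, y, hxy⟩ := NiceEnum.BilinearGroup.exists_not_commute.{u} hB
  refine ⟨NiceEnum.isOmegaCategorical_of_isUltrahomogeneous G hG.ultrahomogeneous
      hc.finitelyManyTerms,
    hc.nilpotencyClass_eq_two (x := f.symm x) (y := f.symm y) fun h => hxy ?_,
    NiceEnum.hasQuantifierElimination_of_isUltrahomogeneous G hG.ultrahomogeneous
      hc.finitelyManyTerms,
    fun h => hB.not_geometricallyFinite (h.of_equiv e)⟩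
  rw [← map_mul, ← map_mul] at h
  exact f.symm.injective h
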